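/- Let $F$ be a probability distribution on $\mathbb R$ with finite mean $-a<0$, and write $\overline F(x)=F(x,\infty)$. Suppose that $F$ is strong subexponential ($F\in\mathcal S^*$), i.e. $\overline F(x)>0$ for all $x$ and $$\int_0^x\overline F(x-y)\overline F(y)\,dy\sim 2a^+\,\overline F(x)\quad\text{as }x\to\infty,\qquad a^+:=\int_0^\infty\overline F(y)\,dy .$$ Let $\xi_1,\xi_2,\dots$ be i.i.d. random variables with distribution $F$, let $S_0=0$, $S_n=\xi_1+\dots+\xi_n$, and, for a random variable $\tau$ with values in $\{0,1,2,\dots\}\cup\{\infty\}$, let $M_\tau=\sup\{S_n: 0\le n\le\tau,\ n<\infty\}$. Say that $\tau$ does not depend on the future jumps of the walk if, for every $n\ge 0$, the $\sigma$-algebras $\sigma\{\xi_1,\dots,\xi_n,\mathbb I\{\tau\le n\}\}$ and $\sigma\{\xi_{n+1},\xi_{n+2},\dots\}$ are independent. Then $$\mathbb P\{M_\tau>x\}\ \sim\ \frac1a\,\mathbb E\int_0^{a\tau}\overline F(x+y)\,dy\qquad\text{as }x\to\infty,$$ uniformly over all such $\tau$ with $\tau\ge1$ almost surely that do not depend on the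 future jumps of the walk; that is, for every $\varepsilon>0$ there is an $x_0$, depending only on $F$ and $\varepsilon$, such that for all $x\ge x_0$, every probability space carrying such a sequence $(\xi_i)$, and every such $\tau$ on it, the ratio of the left side to the right side differs from $1$ by at most $\varepsilon$. -/

import Mathlib

open MeasureTheory ProbabilityTheory Filter Set
open scoped ENNReal Topology

/-- The (right) tail `x ↦ F(x, ∞)` of a distribution `F` on the real line. -/
noncomputable def tail (F : Measure ℝ) (x : ℝ) : ℝ := F.real (Ioi x)

/-- The class of strong subexponential distributions on the real line: `F` has a finite mean,
its tail never vanishes, and `∫₀ˣ F̄(x - y) F̄(y) dy ~ 2 a⁺ F̄(x)` as `x → ∞`,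
where `a⁺ = ∫₀^∞ F̄(y) dy`. -/
structure StrongSubexponential (F : Measure ℝ) : Prop where
  finite_mean : Integrable (fun x : ℝ => x) F
  tail_pos : ∀ x : ℝ, 0 < tail F x
  equiv : Tendsto
    (fun x : ℝ => (∫ y in (0 : ℝ)..x, tail F (x - y) * tail F y) /
      (2 * (∫ y in Ioi (0 : ℝ), tail F y) * tail F x)) atTop (𝓝 1)

section Walk

variable {Ω : Type*}

/-- The random walk `S₀ = 0`, `Sₙ = ξ₁ + ⋯ + ξₙ`; the `i`-th jump `ξᵢ` is `ξ (i - 1)` here. -/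
def walk (ξ : ℕ → Ω → ℝ) (n : ℕ) (ω : Ω) : ℝ := ∑ i ∈ Finset.range n, ξ i ω

/-- The maximum `M_τ` of the walk over the times `0 ≤ n ≤ τ` (`n < ∞`), a supremum in the
extended reals if `τ = ∞`. -/
noncomputable def walkMax (ξ : ℕ → Ω → ℝ) (τ : Ω → ℕ∞) (ω : Ω) : EReal :=
  ⨆ (n : ℕ) (_ : (n : ℕ∞) ≤ τ ω), ((walk ξ n ω : ℝ) : EReal)

/-- `τ` does not depend on the future jumps of the walk: for every `n`, the sigma-algebras
`σ{ξ₁, …, ξₙ, 𝟙{τ ≤ n}}` and `σ{ξₙ₊₁, ξₙ₊₂, …}` are independent. -/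
def NotDependOnFuture [MeasurableSpace Ω] (P : Measure Ω) (ξ : ℕ → Ω → ℝ) (τ : Ω → ℕ∞) : Prop :=
  ∀ n : ℕ, Indep
    ((⨆ (i : ℕ) (_ : i < n), MeasurableSpace.comap (ξ i) (borel ℝ)) ⊔
      MeasurableSpace.generateFrom {{ω | τ ω ≤ (n : ℕ∞)}})
    (⨆ (i : ℕ) (_ : n ≤ i), MeasurableSpace.comap (ξ i) (borel ℝ)) P

/-- `E ∫₀^{aτ} F̄(x + y) dy`, where `aτ = ∞` if `τ = ∞` (and `a > 0`). -/
noncomputable def expectedTailIntegral [MeasurableSpace Ω] (F : Measure ℝ) (P : Measure Ω)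
    (a : ℝ) (τ : Ω → ℕ∞) (x : ℝ) : ℝ≥0∞ :=
  ∫⁻ ω, (∫⁻ y in {y : ℝ | 0 < y ∧
    ENNReal.ofReal y ≤ ENNReal.ofReal a * ((τ ω : ℕ∞) : ℝ≥0∞)}, F (Ioi (x + y))) ∂P

end Walk

set_option linter.unusedSectionVars false

/-! ### Tails, integrated tails, and what strong subexponentiality says about them -/

section TailFacts

variable {F : Measure ℝ} [IsProbabilityMeasure F]

/-! Write G for the integrated tail, R for the right-hand side. The walk exceeds a high level by one
big jump, so P{M_τ > x} should be close to the sum over n of E[F̄(x - S_n); τ > n]; since S_n is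
near -an, this is close to the sum of P{τ > n} F̄(x + an), a Riemann sum for R. The independence
assumption on τ enters through Dynkin's formula for functions of the stopped walk
(`integral_comp_stoppedWalk`): on the event that the walk is still running at time n, the next jump
is fresh.

Upper bound. Strong subexponentiality yields a function h that is 1 on the negatives and cG far out,
with c slightly above 1/a, and for which h(x - walk) is a supermartingale up to the passage above x
when the jumps are truncated below at -K (`exists_lyapunov`). Used alone, it would give only a bound
of order G(x), which ignores τ. Dependence on τ is recovered by subtracting c times Dynkin's formula
for G along the walk whose jumps are clamped to [-K, K]: the starting values cG(x) cancel, and what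
remains is c a₃ times the sum of E[F̄(x - S_n); alive] for the clamped walk, where -a₃ is the
clamped mean (`prob_stoppedWalk_le`).

Lower bound. The probability that the stopped walk ends above x equals the sum of E[F̄(x - S_n);
alive]. The raw walk has no lower exponential moments, so it must be replaced by the clamped one.
This is done by comparing Dynkin's formula for G along the walk truncated above, where convexity of
G suffices, and along the clamped walk, where long-tailedness computes the drift up to a small error
(`mul_sum_setIntegral_tail_le_prob`).

In both directions the clamped walk leaves the line -bn, with b near a, with exponentially small
probability, so its sum agrees with that of P(alive) F̄(x + bn) up to factors near 1 and an error
δF̄(x). As τ ≥ 1, F̄(x) is at most a constant times R and the error is absorbed. Every threshold for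
x depends only on F and δ, whence the uniformity. -/

lemma tail_nonneg (x : ℝ) : 0 ≤ tail F x := measureReal_nonneg

lemma tail_le_one (x : ℝ) : tail F x ≤ 1 := measureReal_le_one

lemma tail_antitone : Antitone (tail F) := fun _ _ h =>
  measureReal_mono (Ioi_subset_Ioi h)

lemma measurable_tail : Measurable (tail F) := tail_antitone.measurable

lemma ofReal_tail (x : ℝ) : ENNReal.ofReal (tail F x) = F (Ioi x) := by
  simp [tail, measureReal_def]

lemma tail_intervalIntegrable (a b : ℝ) : IntervalIntegrable (tail F) volume a b :=
  tail_antitone.intervalIntegrable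

lemma integrableOn_Ioi_tail (hm : Integrable (fun x : ℝ => x) F) (y : ℝ) :
    IntegrableOn (tail F) (Ioi y) := by
  have h0 : IntegrableOn (tail F) (Ioi 0) := by
    refine ⟨measurable_tail.aestronglyMeasurable, ?_⟩
    have h1 := hm.pos_part
    have h2 := lintegral_eq_lintegral_meas_lt F (f := fun x : ℝ => max x 0)
      (Eventually.of_forall fun x => le_max_right _ _) (by fun_prop)
    rw [hasFiniteIntegral_iff_ofReal (Eventually.of_forall fun x => tail_nonneg x)]
    have h3 : ∫⁻ x in Ioi (0 : ℝ), ENNReal.ofReal (tail F x)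
        = ∫⁻ t in Ioi (0 : ℝ), F {a | t < max a 0} := by
      refine setLIntegral_congr_fun measurableSet_Ioi fun t ht => ?_
      simp only [ofReal_tail]
      congr 1
      ext a
      have ht : (0 : ℝ) < t := ht
      simp [ht.le]
    rw [h3, ← h2]
    exact (hasFiniteIntegral_iff_ofReal
      (Eventually.of_forall fun x => le_max_right _ _)).1 h1.2
  have h1 : IntegrableOn (tail F) (Ioc (min y 0) 0) :=
    (tail_intervalIntegrable (min y 0) 0).1
  refine (h1.union h0).mono_set ?_
  rw [Ioc_union_Ioi_eq_Ioi (min_le_right _ _)]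
  exact Ioi_subset_Ioi (min_le_left _ _)

/-- The mean of the positive part, as an integral of the tail. -/
lemma integral_pos_part (hm : Integrable (fun x : ℝ => x) F) :
    ∫ u, max u 0 ∂F = ∫ y in Ioi (0 : ℝ), tail F y := by
  rw [hm.pos_part.integral_eq_integral_meas_lt (Eventually.of_forall fun x => le_max_right _ _)]
  refine setIntegral_congr_fun measurableSet_Ioi fun t ht => ?_
  have ht : (0 : ℝ) < t := ht
  simp only [tail]
  congr 1
  ext a
  simp [ht.le]

/-- The integrated tail `y ↦ ∫_y^∞ F̄`. -/
noncomputable def tailIntegral (F : Measure ℝ) (y : ℝ) : ℝ := ∫ s in Ioi y, tail F s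

lemma tailIntegral_sub (hm : Integrable (fun x : ℝ => x) F) (y z : ℝ) :
    tailIntegral F y - tailIntegral F z = ∫ s in y..z, tail F s :=
  intervalIntegral.integral_Ioi_sub_Ioi' (integrableOn_Ioi_tail hm y) (integrableOn_Ioi_tail hm z)

lemma tailIntegral_nonneg (y : ℝ) : 0 ≤ tailIntegral F y :=
  integral_nonneg fun _ => tail_nonneg _

lemma mul_tail_le_intervalIntegral {y z : ℝ} (h : y ≤ z) :
    (z - y) * tail F z ≤ ∫ s in y..z, tail F s := by
  have := intervalIntegral.integral_mono_on (μ := volume) h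
    (intervalIntegrable_const (c := tail F z)) (tail_intervalIntegrable (F := F) y z)
    fun x hx => tail_antitone hx.2
  simpa using this

lemma intervalIntegral_le_mul_tail {y z : ℝ} (h : y ≤ z) :
    ∫ s in y..z, tail F s ≤ (z - y) * tail F y := by
  have := intervalIntegral.integral_mono_on (μ := volume) h
    (tail_intervalIntegrable (F := F) y z) (intervalIntegrable_const (c := tail F y))
    fun x hx => tail_antitone hx.1
  simpa using this

/-- Convexity of G: its graph lies above the line of slope -F̄(y) through (y, G(y)), whatever the
sign of v. -/
lemma mul_tail_le_tailIntegral_sub (hm : Integrable (fun x : ℝ => x) F) (y v : ℝ) :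
    v * tail F y ≤ tailIntegral F (y - v) - tailIntegral F y := by
  rw [tailIntegral_sub hm]
  rcases le_total 0 v with hv | hv
  · simpa using mul_tail_le_intervalIntegral (F := F) (y := y - v) (z := y) (by linarith)
  · have := intervalIntegral_le_mul_tail (F := F) (y := y) (z := y - v) (by linarith)
    rw [intervalIntegral.integral_symm]
    nlinarith

lemma tailIntegral_sub_le_mul_tail (hm : Integrable (fun x : ℝ => x) F) (y v : ℝ) :
    tailIntegral F (y - v) - tailIntegral F y ≤ v * tail F (y - v) := by
  have := mul_tail_le_tailIntegral_sub hm (y - v) (-v)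
  simp only [sub_neg_eq_add, sub_add_cancel] at this
  linarith

lemma tailIntegral_antitone (hm : Integrable (fun x : ℝ => x) F) :
    Antitone (tailIntegral F) := fun y z h => by
  have h1 := tailIntegral_sub (F := F) hm y z
  have h2 := intervalIntegral.integral_nonneg (μ := volume) h fun u _ => tail_nonneg (F := F) u
  linarith

lemma tendsto_tailIntegral (hm : Integrable (fun x : ℝ => x) F) :
    Tendsto (tailIntegral F) atTop (𝓝 0) := by
  have h := intervalIntegral_tendsto_integral_Ioi (μ := volume) 0 (integrableOn_Ioi_tail hm 0)
    tendsto_id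
  have h2 := (tendsto_const_nhds (x := tailIntegral F 0)).sub h
  rw [show tailIntegral F 0 - ∫ s in Ioi (0 : ℝ), tail F s = 0 from sub_self _] at h2
  refine h2.congr fun x => ?_
  have := tailIntegral_sub hm 0 x
  simp only [id]
  linarith

lemma StrongSubexponential.tailIntegral_zero_pos (hF : StrongSubexponential F) :
    0 < tailIntegral F 0 := by
  have h := mul_tail_le_tailIntegral_sub hF.finite_mean 1 1
  have h1 := hF.tail_pos 1
  have h2 := tailIntegral_nonneg (F := F) 1
  simp only [sub_self] at h
  linarith

/-- Half of the convolution integral of the tail with itself. -/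
noncomputable def halfConv (F : Measure ℝ) (x : ℝ) : ℝ :=
  ∫ y in (0 : ℝ)..x / 2, tail F (x - y) * tail F y

lemma tail_mul_intervalIntegrable (x a b : ℝ) :
    IntervalIntegrable (fun y => tail F (x - y) * tail F y) volume a b := by
  refine (intervalIntegrable_const (c := (1 : ℝ)) (μ := volume)).mono_fun
    ((measurable_tail.comp (measurable_const.sub measurable_id)).mul
      measurable_tail).aestronglyMeasurable (Eventually.of_forall fun y => ?_)
  have h1 := tail_nonneg (F := F) y
  have h2 := tail_nonneg (F := F) (x - y)
  have h3 := tail_le_one (F := F) y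
  have h4 := tail_le_one (F := F) (x - y)
  simp only [Real.norm_eq_abs, abs_one]
  rw [abs_of_nonneg (mul_nonneg h2 h1)]
  exact mul_le_one₀ h4 h1 h3

lemma integral_tail_mul_eq (x : ℝ) :
    ∫ y in (0 : ℝ)..x, tail F (x - y) * tail F y = 2 * halfConv F x := by
  rw [← intervalIntegral.integral_add_adjacent_intervals (tail_mul_intervalIntegrable x 0 (x / 2))
    (tail_mul_intervalIntegrable x (x / 2) x)]
  have h := intervalIntegral.integral_comp_sub_left (a := x / 2) (b := x)
    (fun y => tail F (x - y) * tail F y) x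
  simp only [sub_sub_cancel, sub_self, sub_half] at h
  rw [halfConv, two_mul]
  congr 1
  rw [← h]
  exact intervalIntegral.integral_congr fun y _ => mul_comm _ _

lemma StrongSubexponential.tendsto_halfConv (hF : StrongSubexponential F) :
    Tendsto (fun x => halfConv F x / tail F x) atTop (𝓝 (tailIntegral F 0)) := by
  have h := hF.equiv.const_mul (tailIntegral F 0)
  rw [mul_one] at h
  refine h.congr fun x => ?_
  have h1 := (hF.tail_pos x).ne'
  have h2 := hF.tailIntegral_zero_pos.ne'
  rw [integral_tail_mul_eq, show ∫ y in Ioi (0 : ℝ), tail F y = tailIntegral F 0 from rfl]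
  field_simp

/-- The difference is the integral over [0, x/2] of (F̄(x - y)/F̄(x) - 1) F̄(y). The integrand is
nonnegative, so this one limit gives both long-tailedness and the remainder estimate in the
construction of the Lyapunov function. -/
lemma StrongSubexponential.tendsto_halfConv_sub (hF : StrongSubexponential F) :
    Tendsto (fun x => halfConv F x / tail F x - ∫ y in (0 : ℝ)..x / 2, tail F y) atTop (𝓝 0) := by
  have h := intervalIntegral_tendsto_integral_Ioi (μ := volume) 0
    (integrableOn_Ioi_tail hF.finite_mean 0)
    (tendsto_id.atTop_div_const (zero_lt_two' ℝ))
  have h2 := hF.tendsto_halfConv.sub h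
  rwa [show tailIntegral F 0 - ∫ s in Ioi (0 : ℝ), tail F s = 0 from sub_self _] at h2

/-- A strong subexponential distribution is long-tailed. -/
lemma StrongSubexponential.long_tailed (hF : StrongSubexponential F) (K : ℝ) {δ : ℝ} (hδ : 0 < δ) :
    ∀ᶠ x in atTop, tail F (x - K) ≤ (1 + δ) * tail F x := by
  set T := max K 0 with hT
  have hT0 : 0 ≤ T := le_max_right _ _
  have hp := hF.tail_pos (T + 1)
  have h := hF.tendsto_halfConv_sub.eventually_lt_const (mul_pos hδ hp)
  filter_upwards [h, eventually_ge_atTop (2 * (T + 1))] with x hx hx2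
  have hpx := hF.tail_pos x
  -- A nonnegative integrand dominates its part over the window [T, T + 1], where F̄(x - y) ≥ F̄(x -
  -- T) and F̄(y) ≥ F̄(T + 1).
  have key : (tail F (x - T) - tail F x) * tail F (T + 1)
      ≤ halfConv F x - tail F x * ∫ y in (0 : ℝ)..x / 2, tail F y := by
    rw [halfConv, ← intervalIntegral.integral_const_mul, ← intervalIntegral.integral_sub
      (tail_mul_intervalIntegrable _ _ _) ((tail_intervalIntegrable _ _).const_mul _)]
    have hI : ∀ a b, IntervalIntegrable
        (fun y => tail F (x - y) * tail F y - tail F x * tail F y) volume a b := fun a b =>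
      (tail_mul_intervalIntegrable x a b).sub ((tail_intervalIntegrable a b).const_mul _)
    have hnn : ∀ y, 0 ≤ y → 0 ≤ tail F (x - y) * tail F y - tail F x * tail F y := fun y hy => by
      rw [← sub_mul]
      exact mul_nonneg (sub_nonneg.2 (tail_antitone (by linarith))) (tail_nonneg y)
    calc (tail F (x - T) - tail F x) * tail F (T + 1)
        = ∫ _ in T..(T + 1), (tail F (x - T) - tail F x) * tail F (T + 1) := by simp
      _ ≤ ∫ y in T..(T + 1), (tail F (x - y) * tail F y - tail F x * tail F y) := by
          refine intervalIntegral.integral_mono_on (by linarith) (by simp) (hI _ _)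
            fun y hy => ?_
          rw [← sub_mul]
          have h1 : tail F (x - T) ≤ tail F (x - y) := tail_antitone (by linarith [hy.1])
          have h2 : tail F (T + 1) ≤ tail F y := tail_antitone hy.2
          have h3 : tail F x ≤ tail F (x - T) := tail_antitone (by linarith)
          exact mul_le_mul (by linarith) h2 hp.le (by linarith)
      _ ≤ _ := by
          refine intervalIntegral.integral_mono_interval hT0 (by linarith) (by linarith) ?_ (hI _ _)
          exact (ae_restrict_iff' measurableSet_Ioc).2
            (Eventually.of_forall fun y hy => hnn y hy.1.le)
  have h3 : halfConv F x - tail F x * ∫ y in (0 : ℝ)..x / 2, tail F y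
      < tail F x * (δ * tail F (T + 1)) := by
    have := mul_lt_mul_of_pos_left hx hpx
    rwa [mul_sub, mul_div_cancel₀ _ hpx.ne'] at this
  have h4 : tail F (x - T) - tail F x < tail F x * δ := by
    refine lt_of_mul_lt_mul_right ?_ hp.le
    linarith
  have h5 : tail F (x - K) ≤ tail F (x - T) := tail_antitone (by linarith [le_max_left K 0])
  linarith

/-- Past some point a unit step costs a factor at most exp θ, by long-tailedness; a distance s needs
⌈s⌉ ≤ s + 1 steps. -/
lemma StrongSubexponential.exists_tail_sub_le_exp (hF : StrongSubexponential F) {θ : ℝ}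
    (hθ : 0 < θ) : ∃ u, ∀ x s, 0 ≤ s → u ≤ x - s →
      tail F (x - s) ≤ Real.exp (θ * (s + 1)) * tail F x := by
  have h1 : 0 < Real.exp θ - 1 := by linarith [Real.add_one_lt_exp hθ.ne']
  obtain ⟨u, hu⟩ := eventually_atTop.1 (hF.long_tailed 1 h1)
  refine ⟨u, fun x s hs hx => ?_⟩
  have key : ∀ (k : ℕ) (y : ℝ), u ≤ y → tail F y ≤ Real.exp (θ * k) * tail F (y + k) := by
    intro k
    induction k with
    | zero => intro y _; simp
    | succ k ih =>
      intro y hy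
      have h2 := ih y hy
      have h3 := hu (y + (k + 1 : ℕ)) (by push_cast; linarith [Nat.cast_nonneg (α := ℝ) k])
      rw [show y + ((k + 1 : ℕ) : ℝ) - 1 = y + k by push_cast; ring] at h3
      calc tail F y ≤ Real.exp (θ * k) * tail F (y + k) := h2
        _ ≤ Real.exp (θ * k) * (Real.exp θ * tail F (y + (k + 1 : ℕ))) := by
            gcongr
            linarith
        _ = _ := by
            rw [← mul_assoc, ← Real.exp_add]
            push_cast
            ring_nf
  calc tail F (x - s) ≤ Real.exp (θ * ⌈s⌉₊) * tail F (x - s + ⌈s⌉₊) := key _ _ hx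
    _ ≤ Real.exp (θ * (s + 1)) * tail F x := by
        have h4 := Nat.le_ceil s
        have h5 := (Nat.ceil_lt_add_one hs).le
        exact mul_le_mul (by gcongr) (tail_antitone (by linarith)) (tail_nonneg _) (by positivity)

/-- The tail of a strong subexponential distribution is heavier than exponential. -/
lemma StrongSubexponential.exp_le_tail (hF : StrongSubexponential F) {θ δ : ℝ}
    (hθ : 0 < θ) (hδ : 0 < δ) : ∀ᶠ x in atTop, Real.exp (-(θ * x)) ≤ δ * tail F x := by
  -- Half the rate is spent on bounding F̄(x) below by a multiple of exp(-θx/2); the other factor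
  -- exp(-θx/2) is eventually smaller than any constant.
  obtain ⟨u, hu⟩ := hF.exists_tail_sub_le_exp (half_pos hθ)
  have hp := hF.tail_pos u
  have h1 : Tendsto (fun x => Real.exp (-(θ / 2) * x)) atTop (𝓝 0) :=
    Real.tendsto_exp_atBot.comp (tendsto_id.const_mul_atTop_of_neg (by linarith))
  have h2 := h1.eventually_lt_const
    (show 0 < δ * tail F u * Real.exp (-(θ / 2 * (1 - u))) by positivity)
  filter_upwards [h2, eventually_ge_atTop u] with x hx hxu
  have h3 := hu x (x - u) (by linarith) (by simp)
  rw [sub_sub_cancel] at h3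
  calc Real.exp (-(θ * x)) = Real.exp (-(θ / 2) * x) * Real.exp (-(θ / 2) * x) := by
        rw [← Real.exp_add]; ring_nf
    _ ≤ (δ * tail F u * Real.exp (-(θ / 2 * (1 - u)))) * Real.exp (-(θ / 2) * x) := by gcongr
    _ ≤ (δ * (Real.exp (θ / 2 * (x - u + 1)) * tail F x) * Real.exp (-(θ / 2 * (1 - u))))
          * Real.exp (-(θ / 2) * x) := by gcongr
    _ = δ * tail F x * (Real.exp (θ / 2 * (x - u + 1)) * Real.exp (-(θ / 2 * (1 - u)))
          * Real.exp (-(θ / 2) * x)) := by ring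
    _ = δ * tail F x := by
        rw [← Real.exp_add, ← Real.exp_add]
        ring_nf
        simp

end TailFacts

/-! ### A Lyapunov function for the walk with jumps truncated below -/

section Lyapunov

/-- The function equal to `1` on the negative half-line and to `∫_y^∞ q` for `y ≥ 0`. -/
noncomputable def lyapunov (q : ℝ → ℝ) (y : ℝ) : ℝ :=
  if y < 0 then 1 else ∫ s in Ioi y, q s

variable {F : Measure ℝ} [IsProbabilityMeasure F] {q : ℝ → ℝ}

lemma lyapunov_of_neg {y : ℝ} (h : y < 0) : lyapunov q y = 1 := if_pos h

lemma lyapunov_of_nonneg {y : ℝ} (h : 0 ≤ y) : lyapunov q y = ∫ s in Ioi y, q s :=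
  if_neg h.not_gt

lemma lyapunov_sub (hi : IntegrableOn q (Ioi 0)) {y z : ℝ} (hy : 0 ≤ y) (hz : 0 ≤ z) :
    lyapunov q y - lyapunov q z = ∫ s in y..z, q s := by
  rw [lyapunov_of_nonneg hy, lyapunov_of_nonneg hz]
  exact intervalIntegral.integral_Ioi_sub_Ioi' (hi.mono_set (Ioi_subset_Ioi hy))
    (hi.mono_set (Ioi_subset_Ioi hz))

lemma lyapunov_nonneg (h0 : ∀ s, 0 ≤ q s) (y : ℝ) : 0 ≤ lyapunov q y := by
  unfold lyapunov
  split_ifs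
  · exact zero_le_one
  · exact integral_nonneg fun s => h0 s

lemma lyapunov_antitoneOn (hi : IntegrableOn q (Ioi 0)) (h0 : ∀ s, 0 ≤ q s) :
    AntitoneOn (lyapunov q) (Ici 0) := fun y hy z hz h => by
  have h1 := lyapunov_sub hi hy hz
  have h2 := intervalIntegral.integral_nonneg (μ := volume) h fun u _ => h0 u
  linarith

lemma lyapunov_le (hi : IntegrableOn q (Ioi 0)) (h0 : ∀ s, 0 ≤ q s) (y : ℝ) :
    lyapunov q y ≤ max 1 (lyapunov q 0) := by
  rcases lt_or_ge y 0 with h | h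
  · rw [lyapunov_of_neg h]; exact le_max_left _ _
  · exact (lyapunov_antitoneOn hi h0 self_mem_Ici h h).trans (le_max_right _ _)

lemma measurable_lyapunov (hi : IntegrableOn q (Ioi 0)) (h0 : ∀ s, 0 ≤ q s) :
    Measurable (lyapunov q) := by
  have h : lyapunov q = fun y => if y < 0 then 1 else lyapunov q (max y 0) := by
    funext y
    rcases lt_or_ge y 0 with h | h
    · rw [lyapunov_of_neg h, if_pos h]
    · rw [if_neg h.not_gt, max_eq_left h]
  rw [h]
  refine Measurable.ite measurableSet_Iio measurable_const ?_
  have h2 : Antitone fun y : ℝ => lyapunov q (max y 0) := fun y z h =>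
    lyapunov_antitoneOn hi h0 (le_max_right y 0) (le_max_right z 0) (max_le_max_right 0 h)
  exact h2.measurable

/-- Pathwise accounting of one jump u. A jump beyond y collects all of ∫₀^y q plus the discrepancy 1
- ∫₀^∞ q at the origin; a jump in [0, y] collects q over (y - u, y); a negative jump loses at least
its truncated length times q(y + K), as q is nonincreasing. -/
lemma lyapunov_sub_le (hq : Antitone q) (h0 : ∀ s, 0 ≤ q s) (hi : IntegrableOn q (Ioi 0))
    {K : ℝ} (hK : 0 ≤ K) {y : ℝ} (hy : 0 ≤ y) (u : ℝ) :
    lyapunov q (y - max u (-K)) - lyapunov q y ≤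
      (∫ t in (0 : ℝ)..y, (Iio u).indicator (fun t => q (y - t)) t)
      + (1 - lyapunov q 0) * (Ioi y).indicator 1 u - min (max (-u) 0) K * q (y + K) := by
  have hshift : ∀ b, ∫ t in (0 : ℝ)..b, q (y - t) = ∫ s in (y - b)..y, q s := fun b => by
    rw [intervalIntegral.integral_comp_sub_left, sub_zero]
  have hint : ∀ a b, IntervalIntegrable (fun t => q (y - t)) volume a b := fun a b =>
    Monotone.intervalIntegrable fun s t h => hq (by linarith)
  rcases lt_or_ge y u with hu | hu
  · have e1 : max u (-K) = u := max_eq_left (by linarith)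
    have e2 : max (-u) 0 = 0 := max_eq_right (by linarith)
    have e3 : ∫ t in (0 : ℝ)..y, (Iio u).indicator (fun t => q (y - t)) t
        = ∫ t in (0 : ℝ)..y, q (y - t) :=
      intervalIntegral.integral_congr fun t ht => by
        rw [uIcc_of_le hy] at ht
        exact indicator_of_mem (s := Iio u) (ht.2.trans_lt hu) (fun t => q (y - t))
    rw [e1, e2, e3, hshift, lyapunov_of_neg (by linarith : y - u < 0), min_eq_left hK,
      indicator_of_mem (show u ∈ Ioi y from hu), sub_self, ← lyapunov_sub hi le_rfl hy]
    simp
  · rw [indicator_of_notMem (show u ∉ Ioi y from not_lt.2 hu)]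
    rcases lt_or_ge u 0 with hu0 | hu0
    · have e0 : 0 ≤ ∫ t in (0 : ℝ)..y, (Iio u).indicator (fun t => q (y - t)) t :=
        intervalIntegral.integral_nonneg hy fun t _ => indicator_nonneg (fun _ _ => h0 _) _
      have e1 : min (max (-u) 0) K = -(max u (-K)) := by
        rw [max_eq_left (by linarith), ← min_neg_neg, neg_neg]
      rw [e1]
      set v := max u (-K) with hv
      have hv0 : v ≤ 0 := max_le hu0.le (by linarith)
      have hvK : -K ≤ v := le_max_right _ _
      have e2 := lyapunov_sub hi hy (show 0 ≤ y - v by linarith)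
      have e3 := intervalIntegral.integral_mono_on (μ := volume) (a := y) (b := y - v)
        (f := fun _ => q (y + K)) (g := q) (by linarith) (by simp)
        hq.intervalIntegrable fun s hs => hq (by linarith [hs.2])
      simp only [intervalIntegral.integral_const, smul_eq_mul] at e3
      linarith
    · have e1 : max u (-K) = u := max_eq_left (by linarith)
      have e2 : max (-u) 0 = 0 := max_eq_right (by linarith)
      have hI : ∀ a b, IntervalIntegrable ((Iio u).indicator (fun t => q (y - t))) volume a b :=
        fun a b => ⟨(hint a b).1.indicator measurableSet_Iio,
          (hint a b).2.indicator measurableSet_Iio⟩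
      -- Equality holds only almost everywhere: `Iio u` omits the endpoint t = u.
      have e3 : ∫ t in (0 : ℝ)..u, (Iio u).indicator (fun t => q (y - t)) t
          = ∫ t in (0 : ℝ)..u, q (y - t) := by
        refine intervalIntegral.integral_congr_ae ?_
        filter_upwards [(measure_eq_zero_iff_ae_notMem (μ := volume)).1
          (measure_singleton u)] with t ht ht2
        rw [uIoc_of_le hu0] at ht2
        exact indicator_of_mem (s := Iio u) (lt_of_le_of_ne ht2.2 ht) (fun t => q (y - t))
      have e4 : 0 ≤ ∫ t in u..y, (Iio u).indicator (fun t => q (y - t)) t :=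
        intervalIntegral.integral_nonneg hu fun t _ => indicator_nonneg (fun _ _ => h0 _) _
      rw [e1, e2, min_eq_left hK, lyapunov_sub hi (by linarith) hy,
        ← intervalIntegral.integral_add_adjacent_intervals (hI 0 u) (hI u y), e3, hshift]
      linarith

/-- Integrating the pathwise bound and applying Fubini turns the indicator of {t < u} into F̄(t), so
the upward drift becomes a convolution of F̄ with q, the quantity that strong subexponentiality
controls. -/
lemma integral_lyapunov_sub_le (hq : Antitone q) (h0 : ∀ s, 0 ≤ q s)
    (hi : IntegrableOn q (Ioi 0)) {K : ℝ} (hK : 0 ≤ K) {y : ℝ} (hy : 0 ≤ y) :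
    ∫ u, lyapunov q (y - max u (-K)) ∂F - lyapunov q y ≤
      (∫ t in (0 : ℝ)..y, tail F t * q (y - t)) + (1 - lyapunov q 0) * tail F y
        - (∫ u, min (max (-u) 0) K ∂F) * q (y + K) := by
  have hqm : Measurable q := hq.measurable
  have i1 : Integrable (fun u => lyapunov q (y - max u (-K))) F :=
    Integrable.of_bound ((measurable_lyapunov hi h0).comp (by fun_prop)).aestronglyMeasurable
      (max 1 (lyapunov q 0)) (Eventually.of_forall fun u => by
        rw [Real.norm_eq_abs, abs_of_nonneg (lyapunov_nonneg h0 _)]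
        exact lyapunov_le hi h0 _)
  have i2 : Integrable (fun p : ℝ × ℝ => (Iio p.1).indicator (fun t => q (y - t)) p.2)
      (F.prod (volume.restrict (Ioc 0 y))) := by
    have hmeas : Measurable (fun p : ℝ × ℝ => (Iio p.1).indicator (fun t => q (y - t)) p.2) := by
      have : (fun p : ℝ × ℝ => (Iio p.1).indicator (fun t => q (y - t)) p.2)
          = {p : ℝ × ℝ | p.2 < p.1}.indicator (fun p => q (y - p.2)) := by
        funext p
        simp [indicator_apply]
      rw [this]
      exact (hqm.comp (measurable_const.sub measurable_snd)).indicator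
        (measurableSet_lt measurable_snd measurable_fst)
    refine Integrable.of_bound hmeas.aestronglyMeasurable (q 0) ?_
    have : ∀ᵐ p ∂(F.prod (volume.restrict (Ioc 0 y))), p.2 ∈ Ioc 0 y :=
      Measure.quasiMeasurePreserving_snd.ae (ae_restrict_mem measurableSet_Ioc)
    filter_upwards [this] with p hp
    rw [Real.norm_eq_abs, abs_of_nonneg (indicator_nonneg (fun _ _ => h0 _) _)]
    exact indicator_apply_le' (fun _ => hq (by linarith [hp.2])) fun _ => h0 0
  have hswap := integral_integral_swap
    (f := fun u t => (Iio u).indicator (fun t => q (y - t)) t) i2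
  have i3 : Integrable (fun u => min (max (-u) 0) K) F :=
    Integrable.of_bound (by fun_prop) K (Eventually.of_forall fun u => by
      rw [Real.norm_eq_abs, abs_of_nonneg (le_min (le_max_right _ _) hK)]
      exact min_le_right _ _)
  have i4 : Integrable (fun u => (Ioi y).indicator (1 : ℝ → ℝ) u) F :=
    (integrable_const (1 : ℝ)).indicator measurableSet_Ioi
  have i5 := i2.integral_prod_left
  have h := integral_mono (i1.sub (integrable_const (lyapunov q y)))
    ((i5.add (i4.const_mul (1 - lyapunov q 0))).sub (i3.mul_const (q (y + K))))
    fun u => by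
      have := lyapunov_sub_le hq h0 hi hK hy u
      rwa [intervalIntegral.integral_of_le hy] at this
  have e2 : ∫ t in Ioc 0 y, ∫ u, (Iio u).indicator (fun t => q (y - t)) t ∂F
      = ∫ t in (0 : ℝ)..y, tail F t * q (y - t) := by
    rw [intervalIntegral.integral_of_le hy]
    refine integral_congr_ae (Eventually.of_forall fun t => ?_)
    have : (fun u => (Iio u).indicator (fun t => q (y - t)) t)
        = (Ioi t).indicator (fun _ => q (y - t)) := by
      funext u
      simp [indicator_apply]
    simp only [this]
    rw [integral_indicator measurableSet_Ioi]
    simp [tail]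
  have e3 : ∫ u, (Ioi y).indicator (1 : ℝ → ℝ) u ∂F = tail F y := by
    rw [integral_indicator_one measurableSet_Ioi]
    rfl
  simp only [Pi.sub_apply, Pi.add_apply] at h
  have i6 : Integrable (fun u => (1 - lyapunov q 0) * (Ioi y).indicator (1 : ℝ → ℝ) u) F :=
    i4.const_mul _
  have i7 : Integrable (fun u => (∫ t in Ioc 0 y, (Iio u).indicator (fun t => q (y - t)) t)
      + (1 - lyapunov q 0) * (Ioi y).indicator (1 : ℝ → ℝ) u) F := i5.add i6
  rw [integral_sub i1 (integrable_const _), integral_sub i7 (i3.mul_const _),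
    integral_add i5 i6, integral_const_mul, integral_mul_const, hswap, e2, e3] at h
  simpa using h

/-- A nonincreasing, slowly varying weight going from the value `A` to the value `c`. -/
lemma exists_slow_weight {c δ A y₁ : ℝ} (hc : 0 < c) (hδ : 0 < δ) (hA : c ≤ A) (hy₁ : 0 < y₁) :
    ∃ m : ℝ → ℝ, Antitone m ∧ (∀ y, c ≤ m y) ∧ (∀ y, m y ≤ A) ∧ (∀ y ≤ y₁, m y = A) ∧
      (∀ y, m (y / 2) ≤ (1 + δ) * m y) ∧ ∀ᶠ y in atTop, m y = c := by
  have hpos : ∀ y, 0 < max y y₁ := fun y => hy₁.trans_le (le_max_right _ _)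
  -- The decay is logarithmic: halving y changes the logarithm by at most log 2 < 1, hence the
  -- weight by at most cδ, which is at most δ times the weight.
  refine ⟨fun y => max c (A - c * δ * (Real.log (max y y₁) - Real.log y₁)),
    fun y z h => ?_, fun y => le_max_left _ _, fun y => ?_, fun y hy => ?_, fun y => ?_, ?_⟩
  · have : Real.log (max y y₁) ≤ Real.log (max z y₁) :=
      Real.log_le_log (hpos y) (max_le_max_right _ h)
    exact max_le_max_left _ (by gcongr)
  · have : Real.log y₁ ≤ Real.log (max y y₁) := Real.log_le_log hy₁ (le_max_right _ _)
    refine max_le hA (sub_le_self _ (mul_nonneg (by positivity) (by linarith)))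
  · simp only [max_eq_right hy, sub_self, mul_zero, sub_zero]
    exact max_eq_right hA
  · have h1 : Real.log (max y y₁) - Real.log (max (y / 2) y₁) ≤ 1 := by
      have h2 : Real.log (max y y₁) ≤ Real.log (2 * max (y / 2) y₁) := by
        refine Real.log_le_log (hpos y) (max_le ?_ ?_)
        · linarith [le_max_left (y / 2) y₁]
        · linarith [le_max_right (y / 2) y₁]
      rw [Real.log_mul two_ne_zero (hpos _).ne'] at h2
      linarith [Real.log_two_lt_d9]
    set M := max c (A - c * δ * (Real.log (max y y₁) - Real.log y₁)) with hM
    have hMc : c ≤ M := le_max_left _ _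
    have hMA : A - c * δ * (Real.log (max y y₁) - Real.log y₁) ≤ M := le_max_right _ _
    have h3 : c * δ ≤ δ * M := by rw [mul_comm]; gcongr
    have h4 : c * δ * (Real.log (max y y₁) - Real.log (max (y / 2) y₁)) ≤ c * δ :=
      mul_le_of_le_one_right (by positivity) h1
    refine max_le (by nlinarith) (by nlinarith)
  · have h1 : Tendsto (fun y => Real.log y) atTop atTop := Real.tendsto_log_atTop
    filter_upwards [h1.eventually_ge_atTop (Real.log y₁ + A / (c * δ)), eventually_ge_atTop y₁]
      with y hy hy2
    rw [max_eq_left hy2]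
    refine max_eq_left ?_
    have h2 : A ≤ c * δ * (Real.log y - Real.log y₁) := by
      calc A = c * δ * (A / (c * δ)) := by field_simp
        _ ≤ _ := by gcongr; linarith
    linarith

set_option maxHeartbeats 1000000 in
-- For q = cF̄ the drift at large y is about (cp + 1 - cκ) F̄(y), with p = G(0) and κ the mean
-- downward jump truncated at K; the hypothesis makes this negative. Near the origin that fails to
-- be guaranteed, so q is enlarged by a weight m, large up to some point and then decreasing to c so
-- slowly that the convolution estimate survives.
lemma StrongSubexponential.exists_lyapunov (hF : StrongSubexponential F) {K c : ℝ} (hK : 0 ≤ K)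
    (hc : 0 < c) (h1 : 1 < c * ((∫ u, min (max (-u) 0) K ∂F) - tailIntegral F 0)) :
    ∃ h : ℝ → ℝ, Measurable h ∧ (∃ C, ∀ y, |h y| ≤ C) ∧ (∀ y, 0 ≤ h y) ∧ (∀ y < 0, h y = 1) ∧
      AntitoneOn h (Ici 0) ∧ (∀ y, 0 ≤ y → ∫ u, h (y - max u (-K)) ∂F ≤ h y) ∧
      ∀ᶠ y in atTop, h y = c * tailIntegral F y := by
  set κ := ∫ u, min (max (-u) 0) K ∂F with hκ
  set p := tailIntegral F 0 with hp
  have hp0 : 0 < p := hF.tailIntegral_zero_pos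
  have hκ0 : 0 ≤ κ := integral_nonneg fun u => le_min (le_max_right _ _) hK
  -- At δ = 0 the inequality is the hypothesis; continuity leaves room for all the (1 + δ) losses
  -- below.
  obtain ⟨δ, hδ, hδc⟩ : ∃ δ : ℝ, 0 < δ ∧
      1 < c * (κ / (1 + δ) ^ 2 - (1 + δ) * (p + δ) - δ) := by
    have hcont : ContinuousAt (fun δ : ℝ => c * (κ / (1 + δ) ^ 2 - (1 + δ) * (p + δ) - δ)) 0 := by
      refine ContinuousAt.mul continuousAt_const (ContinuousAt.sub (ContinuousAt.sub
        (ContinuousAt.div continuousAt_const (by fun_prop) (by norm_num)) (by fun_prop))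
        (by fun_prop))
    have h2 := hcont.eventually (lt_mem_nhds (a := 1) (by simpa using h1))
    have h3 := (h2.filter_mono nhdsWithin_le_nhds).and (self_mem_nhdsWithin (s := Ioi (0 : ℝ)))
    obtain ⟨δ, h4, h5⟩ := h3.exists
    exact ⟨δ, h5, h4⟩
  have hη := hF.tendsto_halfConv_sub
  have hJ := hF.tendsto_halfConv.eventually_lt_const (show p < p + δ by linarith)
  obtain ⟨z₀, hz₀⟩ := eventually_atTop.1 ((hJ.and (hη.eventually_lt_const hδ)).and
    (hF.long_tailed K hδ))
  set y₀ := max (max z₀ K) 0 with hy₀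
  have hy₀z : z₀ ≤ y₀ := (le_max_left _ _).trans (le_max_left _ _)
  have hy₀K : K ≤ y₀ := (le_max_right _ _).trans (le_max_left _ _)
  have hy₀0 : 0 ≤ y₀ := le_max_right _ _
  have hlong : ∀ y, y₀ ≤ y → tail F y ≤ (1 + δ) * tail F (y + K) := fun y hy => by
    have := (hz₀ (y + K) (by linarith)).2
    rwa [add_sub_cancel_right] at this
  have hT0 := hF.tail_pos y₀
  -- The choice gives A F̄(y₀) ≥ c, so below y₀ the downward drift beats the crude bound F̄(y) ≤ 1
  -- on the cost of crossing.
  set A := max c (c / tail F y₀) with hA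
  have hA0 : 0 < A := hc.trans_le (le_max_left _ _)
  obtain ⟨z₁, hz₁⟩ := eventually_atTop.1
    (hη.eventually_lt_const (show 0 < δ * c / A by positivity))
  -- The weight stays at A up to y₁ ≥ y₀ + K, so that q(y + K) is still large for y < y₀; it starts
  -- to decrease only where the remainder of the convolution is below δc/A.
  set y₁ := max (max z₁ (y₀ + K)) 1 with hy₁
  have hy₁z : z₁ ≤ y₁ := (le_max_left _ _).trans (le_max_left _ _)
  have hy₁K : y₀ + K ≤ y₁ := (le_max_right _ _).trans (le_max_left _ _)
  have hy₁0 : 0 < y₁ := zero_lt_one.trans_le (le_max_right _ _)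
  obtain ⟨m, hm, hmc, hmA, hm1, hm2, hm3⟩ :=
    exists_slow_weight hc hδ (le_max_left c (c / tail F y₀)) hy₁0
  rw [← hA] at hmA hm1
  have hm0 : ∀ y, 0 ≤ m y := fun y => hc.le.trans (hmc y)
  -- Freezing the tail below y₀ keeps q bounded by A F̄(y₀) there, the very constant that the
  -- downward drift is measured against.
  set q : ℝ → ℝ := fun s => m s * tail F (max s y₀) with hq
  have hqanti : Antitone q := fun s t h => by
    exact mul_le_mul (hm h) (tail_antitone (max_le_max_right _ h)) (tail_nonneg _) (hm0 _)
  have hq0 : ∀ s, 0 ≤ q s := fun s => mul_nonneg (hm0 s) (tail_nonneg _)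
  have hqle : ∀ s, q s ≤ m s * tail F s := fun s =>
    mul_le_mul_of_nonneg_left (tail_antitone (le_max_left _ _)) (hm0 s)
  have hqleA : ∀ s, q s ≤ A * tail F s := fun s =>
    (hqle s).trans (mul_le_mul_of_nonneg_right (hmA s) (tail_nonneg _))
  have hqi : IntegrableOn q (Ioi 0) := by
    refine ((integrableOn_Ioi_tail hF.finite_mean 0).const_mul A).mono'
      hqanti.measurable.aestronglyMeasurable (Eventually.of_forall fun s => ?_)
    rw [Real.norm_eq_abs, abs_of_nonneg (hq0 s)]
    exact hqleA s
  have hqI : ∀ a b, IntervalIntegrable q volume a b := fun a b => hqanti.intervalIntegrable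
  have hqI' : ∀ y a b, IntervalIntegrable (fun t => q (y - t)) volume a b := fun y a b =>
    Monotone.intervalIntegrable fun s t h => hqanti (by linarith)
  have hbdd : ∀ y a b, IntervalIntegrable (fun t => tail F t * q (y - t)) volume a b :=
    fun y a b => by
      refine (hqI' y a b).mono_fun (measurable_tail.aestronglyMeasurable.mul
        (hqanti.measurable.comp (measurable_const.sub measurable_id)).aestronglyMeasurable)
        (Eventually.of_forall fun t => ?_)
      simp only [norm_mul]
      refine mul_le_of_le_one_left (norm_nonneg _) ?_
      rw [Real.norm_eq_abs, abs_of_nonneg (tail_nonneg _)]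
      exact tail_le_one t
  refine ⟨lyapunov q, measurable_lyapunov hqi hq0, ⟨max 1 (lyapunov q 0), fun y => ?_⟩, lyapunov_nonneg hq0,
    fun y hy => lyapunov_of_neg hy, lyapunov_antitoneOn hqi hq0, fun y hy => ?_, ?_⟩
  · rw [abs_of_nonneg (lyapunov_nonneg hq0 _)]
    exact lyapunov_le hqi hq0 y
  · have hd := integral_lyapunov_sub_le (F := F) hqanti hq0 hqi hK hy
    rw [← hκ] at hd
    have hQ : 0 ≤ lyapunov q 0 := lyapunov_nonneg hq0 0
    have hbr : κ / (1 + δ) ^ 2 ≤ κ / (1 + δ) :=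
      div_le_div_of_nonneg_left hκ0 (by linarith) (by nlinarith)
    have hbr2 : p ≤ (1 + δ) * (p + δ) := by nlinarith
    suffices (∫ t in (0 : ℝ)..y, tail F t * q (y - t)) + (1 - lyapunov q 0) * tail F y
        ≤ κ * q (y + K) by linarith
    rcases lt_or_ge y y₀ with hyy | hyy
    · have e1 : ∫ t in (0 : ℝ)..y, tail F t * q (y - t) ≤ A * tail F y₀ * p := by
        calc ∫ t in (0 : ℝ)..y, tail F t * q (y - t)
            ≤ ∫ t in (0 : ℝ)..y, tail F t * (A * tail F y₀) := by
              refine intervalIntegral.integral_mono_on hy (hbdd _ _ _)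
                ((tail_intervalIntegrable _ _).mul_const _) fun t ht => ?_
              refine mul_le_mul_of_nonneg_left ?_ (tail_nonneg _)
              exact mul_le_mul (hmA _) (tail_antitone (le_max_right _ _)) (tail_nonneg _) hA0.le
          _ = (p - tailIntegral F y) * (A * tail F y₀) := by
              rw [intervalIntegral.integral_mul_const, ← tailIntegral_sub hF.finite_mean]
          _ ≤ p * (A * tail F y₀) := by
              gcongr
              linarith [tailIntegral_nonneg (F := F) y]
          _ = _ := by ring
      have e2 : (1 - lyapunov q 0) * tail F y ≤ 1 := by
        have h1 := tail_nonneg (F := F) y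
        have h2 := tail_le_one (F := F) y
        nlinarith
      have e3 : A * (tail F y₀ / (1 + δ)) ≤ q (y + K) := by
        have h1 : m (y₀ + K) = A := hm1 _ hy₁K
        have h2 : A * tail F (y₀ + K) = q (y₀ + K) := by
          simp only [hq]
          rw [h1, max_eq_left (by linarith)]
        calc A * (tail F y₀ / (1 + δ)) ≤ A * tail F (y₀ + K) := by
              gcongr
              rw [div_le_iff₀ (by linarith), mul_comm]
              exact hlong y₀ le_rfl
          _ = q (y₀ + K) := h2
          _ ≤ q (y + K) := hqanti (by linarith)
      have e4 : c ≤ A * tail F y₀ := by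
        calc c = c / tail F y₀ * tail F y₀ := by field_simp
          _ ≤ _ := by gcongr; exact le_max_right _ _
      have e5 : 1 ≤ A * tail F y₀ * (κ / (1 + δ) - p) := by
        have h3 : 1 < c * (κ / (1 + δ) - p) := by
          refine hδc.trans_le (mul_le_mul_of_nonneg_left ?_ hc.le)
          linarith
        have h4 : 0 < κ / (1 + δ) - p := by
          by_contra hcon
          push Not at hcon
          nlinarith
        exact h3.le.trans (mul_le_mul_of_nonneg_right e4 h4.le)
      have e6 := mul_le_mul_of_nonneg_left e3 hκ0
      have e7 : κ * (A * (tail F y₀ / (1 + δ))) = A * tail F y₀ * (κ / (1 + δ)) := by ring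
      linarith
    · have hTy := hF.tail_pos y
      have hmy := hmc y
      obtain ⟨⟨hJy, hηy⟩, -⟩ := hz₀ y (hy₀z.trans hyy)
      -- The negative term -h(0) F̄(y), with h(0) ≥ ∫₀^y q, is used to replace F̄(t) by F̄(t) -
      -- F̄(y). This removes the contribution of t near y, where q(y - t) is of the large order A.
      have e0 : (∫ t in (0 : ℝ)..y, tail F t * q (y - t)) + (1 - lyapunov q 0) * tail F y
          ≤ (∫ t in (0 : ℝ)..y, (tail F t * q (y - t) - tail F y * q (y - t))) + tail F y := by
        rw [intervalIntegral.integral_sub (hbdd _ _ _) ((hqI' _ _ _).const_mul _),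
          intervalIntegral.integral_const_mul, intervalIntegral.integral_comp_sub_left q y,
          sub_self, sub_zero, ← lyapunov_sub hqi le_rfl hy]
        have := mul_nonneg hTy.le (lyapunov_nonneg hq0 y)
        linarith
      have hsubI : ∀ a b, IntervalIntegrable
          (fun t => tail F t * q (y - t) - tail F y * q (y - t)) volume a b := fun a b =>
        (hbdd _ _ _).sub ((hqI' _ _ _).const_mul _)
      -- For t ≤ y/2 the weight at y - t is at most (1 + δ) m(y), by slow variation.
      have e1 : ∫ t in (0 : ℝ)..(y / 2), (tail F t * q (y - t) - tail F y * q (y - t))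
          ≤ (1 + δ) * m y * halfConv F y := by
        rw [halfConv, ← intervalIntegral.integral_const_mul]
        refine intervalIntegral.integral_mono_on (by linarith) (hsubI _ _)
          ((tail_mul_intervalIntegrable _ _ _).const_mul _) fun t ht => ?_
        have h1 : q (y - t) ≤ (1 + δ) * m y * tail F (y - t) :=
          (hqle _).trans (mul_le_mul_of_nonneg_right
            ((hm (by linarith [ht.2])).trans (hm2 y)) (tail_nonneg _))
        have h2 := mul_nonneg hTy.le (hq0 (y - t))
        have h3 := mul_le_mul_of_nonneg_left h1 (tail_nonneg (F := F) t)
        linarith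
      -- For t ≥ y/2 only m ≤ A is available, but after s = y - t the factor F̄(y - s) - F̄(y) makes
      -- the integral A times a quantity that is o(F̄(y)).
      have e2 : ∫ t in (y / 2)..y, (tail F t * q (y - t) - tail F y * q (y - t))
          ≤ A * (halfConv F y - tail F y * ∫ s in (0 : ℝ)..(y / 2), tail F s) := by
        have h1 := intervalIntegral.integral_comp_sub_left (a := y / 2) (b := y)
          (fun s => tail F (y - s) * q s - tail F y * q s) y
        simp only [sub_sub_cancel, sub_self, sub_half] at h1
        have h4 := tail_mul_intervalIntegrable (F := F) y 0 (y / 2)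
        have h5 : IntervalIntegrable (fun s => tail F y * tail F s) volume 0 (y / 2) :=
          (tail_intervalIntegrable _ _).const_mul _
        rw [h1, halfConv, ← intervalIntegral.integral_const_mul,
          ← intervalIntegral.integral_sub h4 h5, ← intervalIntegral.integral_const_mul]
        refine intervalIntegral.integral_mono_on (by linarith) ?_ ((h4.sub h5).const_mul _)
          fun s hs => ?_
        · have h2 := (hbdd y (y / 2) y).comp_sub_left y
          simp only [sub_sub_cancel, sub_self, sub_half] at h2
          exact h2.symm.sub ((hqI _ _).const_mul _)
        · have h2 : tail F y ≤ tail F (y - s) := tail_antitone (by linarith [hs.1])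
          have h3 := mul_le_mul_of_nonneg_left (hqleA s) (sub_nonneg.2 h2)
          rw [← sub_mul, ← sub_mul]
          exact h3.trans_eq (by ring)
      have e3 : A * (halfConv F y - tail F y * ∫ s in (0 : ℝ)..(y / 2), tail F s)
          ≤ δ * m y * tail F y := by
        have h1 : halfConv F y - tail F y * ∫ s in (0 : ℝ)..(y / 2), tail F s
            = tail F y * (halfConv F y / tail F y - ∫ s in (0 : ℝ)..(y / 2), tail F s) := by
          field_simp
        rw [h1, mul_left_comm, mul_comm (δ * m y)]
        -- Before y₁ the weight equals A and a remainder below δ is enough; after y₁ the remainder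
        -- is below δc/A and m ≥ c.
        have h2 : A * (halfConv F y / tail F y - ∫ s in (0 : ℝ)..(y / 2), tail F s)
            ≤ δ * m y := by
          rcases le_total y y₁ with h | h
          · rw [hm1 y h, mul_comm]
            gcongr
          · have h3 := hz₁ y (hy₁z.trans h)
            calc _ ≤ A * (δ * c / A) := by gcongr
              _ = δ * c := by field_simp
              _ ≤ δ * m y := by gcongr
        exact mul_le_mul_of_nonneg_left h2 hTy.le
      have e4 : halfConv F y ≤ (p + δ) * tail F y := by
        rw [div_lt_iff₀ hTy] at hJy
        exact hJy.le
      have e5 : m y * tail F y / (1 + δ) ^ 2 ≤ q (y + K) := by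
        have h1 : m y ≤ (1 + δ) * m (y + K) := (hm (by linarith)).trans (hm2 (y + K))
        have h2 := hlong y hyy
        simp only [hq]
        rw [max_eq_left (by linarith), div_le_iff₀ (by positivity)]
        calc m y * tail F y ≤ ((1 + δ) * m (y + K)) * ((1 + δ) * tail F (y + K)) :=
              mul_le_mul h1 h2 hTy.le (mul_nonneg (by linarith) (hm0 _))
          _ = _ := by ring
      have e6 : 1 ≤ m y * (κ / (1 + δ) ^ 2 - (1 + δ) * (p + δ) - δ) := by
        have h4 : 0 < κ / (1 + δ) ^ 2 - (1 + δ) * (p + δ) - δ := by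
          by_contra hcon
          push Not at hcon
          nlinarith
        exact hδc.le.trans (mul_le_mul_of_nonneg_right hmy h4.le)
      have e7 := intervalIntegral.integral_add_adjacent_intervals (hsubI 0 (y / 2))
        (hsubI (y / 2) y)
      have e8 := mul_le_mul_of_nonneg_left e5 hκ0
      have e9 := mul_le_mul_of_nonneg_left e4
        (mul_nonneg (show (0 : ℝ) ≤ 1 + δ by linarith) (hm0 y))
      have e10 := mul_le_mul_of_nonneg_right e6 hTy.le
      have e11 : κ * (m y * tail F y / (1 + δ) ^ 2) = m y * (κ / (1 + δ) ^ 2) * tail F y := by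
        ring
      linarith
  · obtain ⟨y₂, hy₂⟩ := eventually_atTop.1 hm3
    filter_upwards [eventually_ge_atTop (max (max y₂ y₀) 0)] with y hy
    have h0 : 0 ≤ y := (le_max_right _ _).trans hy
    have h2 : y₂ ≤ y := ((le_max_left _ _).trans (le_max_left _ _)).trans hy
    have h3 : y₀ ≤ y := ((le_max_right _ _).trans (le_max_left _ _)).trans hy
    rw [lyapunov_of_nonneg h0, tailIntegral, ← integral_const_mul]
    refine setIntegral_congr_fun measurableSet_Ioi fun s hs => ?_
    have hs : y < s := hs
    simp only [hq]
    rw [hy₂ s (by linarith), max_eq_left (by linarith)]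

end Lyapunov

/-! ### Stopped walks and Dynkin's formula -/

section StoppedWalk

variable {Ω : Type*}

/-- The sigma-algebra generated by the first `n` jumps and the event `τ ≤ n`. -/
abbrev past (ξ : ℕ → Ω → ℝ) (τ : Ω → ℕ∞) (n : ℕ) : MeasurableSpace Ω :=
  (⨆ (i : ℕ) (_ : i < n), MeasurableSpace.comap (ξ i) (borel ℝ)) ⊔
    MeasurableSpace.generateFrom {{ω | τ ω ≤ (n : ℕ∞)}}

/-- The sum of those of the first `m` jumps that occur while the walk is not stopped, where `A n`
is the event that the walk is not stopped at time `n`. -/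
noncomputable def stoppedWalk (A : ℕ → Set Ω) (X : ℕ → Ω → ℝ) (m : ℕ) (ω : Ω) : ℝ :=
  ∑ i ∈ Finset.range m, (A i).indicator (X i) ω

/-- The event that `τ` exceeds `n` and that two walks stay below given levels up to time `n`. -/
def aliveSet (τ : Ω → ℕ∞) (X : ℕ → Ω → ℝ) (x : ℝ) (Y : ℕ → Ω → ℝ) (y : ℝ) (n : ℕ) : Set Ω :=
  {ω | (n : ℕ∞) < τ ω ∧ ∀ k ≤ n, walk X k ω ≤ x ∧ walk Y k ω ≤ y}

lemma stoppedWalk_succ (A : ℕ → Set Ω) (X : ℕ → Ω → ℝ) (n : ℕ) (ω : Ω) :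
    stoppedWalk A X (n + 1) ω = stoppedWalk A X n ω + (A n).indicator (X n) ω :=
  Finset.sum_range_succ _ _

lemma walk_mono {X Y : ℕ → Ω → ℝ} (h : ∀ i ω, X i ω ≤ Y i ω) (n : ℕ) (ω : Ω) :
    walk X n ω ≤ walk Y n ω := Finset.sum_le_sum fun i _ => h i ω

lemma stoppedWalk_mono {A : ℕ → Set Ω} {X Y : ℕ → Ω → ℝ} (h : ∀ i ω, X i ω ≤ Y i ω) (n : ℕ)
    (ω : Ω) : stoppedWalk A X n ω ≤ stoppedWalk A Y n ω :=
  Finset.sum_le_sum fun i _ => indicator_le_indicator (h i ω)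

lemma stoppedWalk_eq_walk {A : ℕ → Set Ω} (X : ℕ → Ω → ℝ) {n : ℕ} {ω : Ω}
    (h : ∀ i < n, ω ∈ A i) : stoppedWalk A X n ω = walk X n ω :=
  Finset.sum_congr rfl fun i hi => indicator_of_mem (h i (Finset.mem_range.1 hi)) _

/-- A stopped walk is the walk at some earlier time up to which it was not stopped. -/
lemma exists_stoppedWalk_eq_walk {A : ℕ → Set Ω} (hA : Antitone A) (X : ℕ → Ω → ℝ) (m : ℕ)
    (ω : Ω) : ∃ k ≤ m, stoppedWalk A X m ω = walk X k ω ∧ ∀ i < k, ω ∈ A i := by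
  induction m with
  | zero => exact ⟨0, le_rfl, rfl, by simp⟩
  | succ m ih =>
    by_cases h : ω ∈ A m
    · have h2 : ∀ i < m + 1, ω ∈ A i := fun i hi => hA (Nat.lt_succ_iff.1 hi) h
      exact ⟨m + 1, le_rfl, stoppedWalk_eq_walk X h2, h2⟩
    · obtain ⟨k, hk, h1, h2⟩ := ih
      refine ⟨k, hk.trans (Nat.le_succ m), ?_, h2⟩
      rw [stoppedWalk_succ, indicator_of_notMem h, add_zero, h1]

lemma aliveSet_antitone (τ : Ω → ℕ∞) (X : ℕ → Ω → ℝ) (x : ℝ) (Y : ℕ → Ω → ℝ) (y : ℝ) :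
    Antitone (aliveSet τ X x Y y) := fun _ _ h _ hω =>
  ⟨(Nat.cast_le.2 h).trans_lt hω.1, fun k hk => hω.2 k (hk.trans h)⟩

lemma measurable_past_walk (ξ : ℕ → Ω → ℝ) (τ : Ω → ℕ∞) {ζ : ℝ → ℝ} (hζ : Measurable ζ)
    {k n : ℕ} (h : k ≤ n) : Measurable[past ξ τ n] (walk (fun i ω => ζ (ξ i ω)) k) := by
  refine @Finset.measurable_fun_sum _ _ _ _ _ _ (past ξ τ n) _ _ fun i hi => ?_
  have h1 : MeasurableSpace.comap (ξ i) (borel ℝ) ≤ past ξ τ n :=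
    (le_iSup₂ (f := fun (i : ℕ) (_ : i < n) => MeasurableSpace.comap (ξ i) (borel ℝ)) i
      ((Finset.mem_range.1 hi).trans_le h)).trans le_sup_left
  exact hζ.comp (Measurable.mono (comap_measurable (ξ i)) h1 le_rfl)

lemma measurableSet_past_aliveSet (ξ : ℕ → Ω → ℝ) (τ : Ω → ℕ∞) {ζ ζ' : ℝ → ℝ}
    (hζ : Measurable ζ) (hζ' : Measurable ζ') (x y : ℝ) (n : ℕ) :
    MeasurableSet[past ξ τ n]
      (aliveSet τ (fun i ω => ζ (ξ i ω)) x (fun i ω => ζ' (ξ i ω)) y n) := by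
  have h1 : MeasurableSet[past ξ τ n] {ω | τ ω ≤ (n : ℕ∞)} :=
    (le_sup_right : _ ≤ past ξ τ n) _ (MeasurableSpace.measurableSet_generateFrom rfl)
  have h2 : aliveSet τ (fun i ω => ζ (ξ i ω)) x (fun i ω => ζ' (ξ i ω)) y n
      = {ω | τ ω ≤ (n : ℕ∞)}ᶜ ∩ ⋂ (k : ℕ) (_ : k ≤ n),
        (walk (fun i ω => ζ (ξ i ω)) k ⁻¹' Iic x ∩ walk (fun i ω => ζ' (ξ i ω)) k ⁻¹' Iic y) := by
    ext ω
    simp [aliveSet]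
  rw [h2]
  refine MeasurableSet.inter (MeasurableSet.compl h1) (MeasurableSet.iInter fun k =>
    MeasurableSet.iInter fun hk => MeasurableSet.inter ?_ ?_)
  · exact measurable_past_walk ξ τ hζ hk measurableSet_Iic
  · exact measurable_past_walk ξ τ hζ' hk measurableSet_Iic

variable [mΩ : MeasurableSpace Ω] {P : Measure Ω} [IsProbabilityMeasure P]
  {ξ : ℕ → Ω → ℝ} {τ : Ω → ℕ∞}

lemma measurable_walk {X : ℕ → Ω → ℝ} (hX : ∀ i, Measurable (X i)) (n : ℕ) :
    Measurable (walk X n) := Finset.measurable_fun_sum _ fun i _ => hX i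

lemma past_le (hξ : ∀ i, Measurable (ξ i)) (hτ : Measurable τ) (n : ℕ) : past ξ τ n ≤ mΩ := by
  refine sup_le (iSup₂_le fun i _ => (hξ i).comap_le) (MeasurableSpace.generateFrom_le ?_)
  rintro _ rfl
  exact hτ (MeasurableSet.of_discrete (s := Iic (n : ℕ∞)))

lemma NotDependOnFuture.indep_past (h : NotDependOnFuture P ξ τ) (n : ℕ) :
    Indep (past ξ τ n) (MeasurableSpace.comap (ξ n) (borel ℝ)) P :=
  indep_of_indep_of_le_right (h n)
    (le_iSup₂ (f := fun (i : ℕ) (_ : n ≤ i) => MeasurableSpace.comap (ξ i) (borel ℝ)) n le_rfl)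

/-- Integrating out a random variable that is independent of a sigma-algebra. -/
lemma setIntegral_comp_of_indep {Ω : Type*} {m mΩ : MeasurableSpace Ω} {P : Measure Ω}
    [IsProbabilityMeasure P] {F : Measure ℝ} [IsProbabilityMeasure F] (hm : m ≤ mΩ) {X : Ω → ℝ} (hX : Measurable X) (hXF : P.map X = F)
    (hind : Indep m (MeasurableSpace.comap X (borel ℝ)) P) {A : Set Ω} (hA : MeasurableSet[m] A)
    {U : Ω → ℝ} (hU : Measurable[m] U) {φ : ℝ × ℝ → ℝ} (hφ : Measurable φ) {C : ℝ}
    (hC : ∀ p, |φ p| ≤ C) :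
    ∫ ω in A, φ (U ω, X ω) ∂P = ∫ ω in A, ∫ u, φ (U ω, u) ∂F ∂P := by
  -- Carrying the indicator of A as a second coordinate reduces the claim to Fubini for the product
  -- law of V and X.
  set V : Ω → ℝ × ℝ := fun ω => (U ω, A.indicator 1 ω) with hV
  have hVm : Measurable[m] V :=
    Measurable.prodMk hU ((measurable_const (a := (1 : ℝ))).indicator hA)
  have hVm' : Measurable V := hVm.mono hm le_rfl
  have hAm : MeasurableSet A := hm _ hA
  have hUm : Measurable U := hU.mono hm le_rfl
  have hVX : IndepFun V X P :=
    (IndepFun_iff_Indep _ _ _).2 (indep_of_indep_of_le_left hind hVm.comap_le)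
  have hmap := (indepFun_iff_map_prod_eq_prod_map_map hVm'.aemeasurable hX.aemeasurable).1 hVX
  rw [hXF] at hmap
  have : IsProbabilityMeasure (P.map V) := Measure.isProbabilityMeasure_map hVm'.aemeasurable
  have e1 : ∀ ψ : Ω → ℝ, ∫ ω in A, ψ ω ∂P = ∫ ω, (V ω).2 * ψ ω ∂P := fun ψ => by
    rw [← integral_indicator hAm]
    congr 1
    funext ω
    by_cases h : ω ∈ A <;> simp [hV, h]
  have hφ2 : Measurable fun p : (ℝ × ℝ) × ℝ => p.1.2 * φ (p.1.1, p.2) :=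
    (measurable_snd.comp measurable_fst).mul
      (hφ.comp ((measurable_fst.comp measurable_fst).prodMk measurable_snd))
  have hint : Integrable (fun p : (ℝ × ℝ) × ℝ => p.1.2 * φ (p.1.1, p.2)) ((P.map V).prod F) := by
    rw [← hmap, integrable_map_measure hφ2.aestronglyMeasurable (hVm'.prodMk hX).aemeasurable]
    refine Integrable.of_bound (hφ2.comp (hVm'.prodMk hX)).aestronglyMeasurable C
      (Eventually.of_forall fun ω => ?_)
    simp only [Function.comp, hV, norm_mul, Real.norm_eq_abs]
    have hC0 : 0 ≤ C := (abs_nonneg _).trans (hC 0)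
    by_cases h : ω ∈ A
    · simpa [h] using hC _
    · simpa [h] using hC0
  have hF : Measurable fun v : ℝ × ℝ => v.2 * ∫ u, φ (v.1, u) ∂F :=
    measurable_snd.mul ((hφ.stronglyMeasurable.integral_prod_right').measurable.comp
      measurable_fst)
  calc ∫ ω in A, φ (U ω, X ω) ∂P
      = ∫ p, p.1.2 * φ (p.1.1, p.2) ∂(P.map fun ω => (V ω, X ω)) := by
        rw [e1, integral_map (hVm'.prodMk hX).aemeasurable hφ2.aestronglyMeasurable]
    _ = ∫ v, v.2 * ∫ u, φ (v.1, u) ∂F ∂(P.map V) := by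
        rw [hmap, integral_prod _ hint]
        simp only [integral_const_mul]
    _ = _ := by
        rw [e1, integral_map hVm'.aemeasurable hF.aestronglyMeasurable]

/-- Dynkin's formula for a function of a stopped walk. -/
lemma integral_comp_stoppedWalk {F : Measure ℝ} [IsProbabilityMeasure F]
    (hξ : ∀ i, Measurable (ξ i)) (hmap : ∀ i, P.map (ξ i) = F) (hτ : Measurable τ)
    (hfut : NotDependOnFuture P ξ τ) {A : ℕ → Set Ω} (hA : Antitone A)
    (hAm : ∀ n, MeasurableSet[past ξ τ n] (A n)) {ζ g : ℝ → ℝ} (hζ : Measurable ζ)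
    (hg : Measurable g) {C : ℝ} (hC : ∀ y, |g y| ≤ C) (x : ℝ) (m : ℕ) :
    ∫ ω, g (x - stoppedWalk A (fun i ω => ζ (ξ i ω)) m ω) ∂P = g x + ∑ n ∈ Finset.range m,
      ∫ ω in A n, (∫ u, g (x - walk (fun i ω => ζ (ξ i ω)) n ω - ζ u) ∂F
        - g (x - walk (fun i ω => ζ (ξ i ω)) n ω)) ∂P := by
  set X : ℕ → Ω → ℝ := fun i ω => ζ (ξ i ω) with hX
  have hXm : ∀ i, Measurable (X i) := fun i => hζ.comp (hξ i)
  have hAm' : ∀ n, MeasurableSet (A n) := fun n => past_le hξ hτ n _ (hAm n)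
  have hW : ∀ m, Measurable (stoppedWalk A X m) := fun m =>
    Finset.measurable_fun_sum _ fun i _ => (hXm i).indicator (hAm' i)
  have hS : ∀ m, Measurable (walk X m) := measurable_walk hXm
  have hgi : ∀ {f : Ω → ℝ} (μ : Measure Ω) [IsFiniteMeasure μ], Measurable f →
      Integrable (fun ω => g (f ω)) μ := fun μ _ hf =>
    Integrable.of_bound (hg.comp hf).aestronglyMeasurable C (Eventually.of_forall fun ω => hC _)
  induction m with
  | zero => simp [stoppedWalk]
  | succ m ih =>
    rw [Finset.sum_range_succ, ← add_assoc, ← ih]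
    -- Off `A m` the stopped walk is frozen; on `A m` it has never been stopped and equals the walk,
    -- as the events decrease.
    have e1 : ∀ ω, g (x - stoppedWalk A X (m + 1) ω) = g (x - stoppedWalk A X m ω)
        + (A m).indicator (fun ω => g (x - walk X m ω - ζ (ξ m ω)) - g (x - walk X m ω)) ω := by
      intro ω
      rw [stoppedWalk_succ]
      by_cases h : ω ∈ A m
      · rw [indicator_of_mem h, indicator_of_mem h,
          stoppedWalk_eq_walk X fun i hi => hA hi.le h, ← sub_sub]
        simp [hX]
      · rw [indicator_of_notMem h, indicator_of_notMem h, add_zero, add_zero]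
    simp only [e1]
    have i1 : Integrable (fun ω => g (x - walk X m ω - ζ (ξ m ω))) (P.restrict (A m)) :=
      hgi _ ((measurable_const.sub (hS m)).sub (hXm m))
    have i2 : Integrable (fun ω => g (x - walk X m ω)) (P.restrict (A m)) :=
      hgi _ (measurable_const.sub (hS m))
    have hφ : Measurable fun p : ℝ × ℝ => g (x - p.1 - ζ p.2) :=
      hg.comp ((measurable_const.sub measurable_fst).sub (hζ.comp measurable_snd))
    have i3 : Integrable (fun ω => ∫ u, g (x - walk X m ω - ζ u) ∂F) (P.restrict (A m)) := by
      refine Integrable.of_bound ((hφ.stronglyMeasurable.integral_prod_right').measurable.comp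
        (hS m)).aestronglyMeasurable C (Eventually.of_forall fun ω => ?_)
      refine (norm_integral_le_of_norm_le_const (Eventually.of_forall fun u => hC _)).trans ?_
      simp
    have i4 : Integrable (fun ω => g (x - stoppedWalk A X m ω)) P :=
      hgi P (measurable_const.sub (hW m))
    have i5 : Integrable ((A m).indicator fun ω => g (x - walk X m ω - ζ (ξ m ω))
      - g (x - walk X m ω)) P := (integrable_indicator_iff (hAm' m)).2 (i1.sub i2)
    rw [integral_add i4 i5, integral_indicator (hAm' m),
      integral_sub i1 i2, integral_sub i3 i2]
    congr 2
    exact setIntegral_comp_of_indep (past_le hξ hτ m) (hξ m) (hmap m) (hfut.indep_past m) (hAm m)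
      (measurable_past_walk ξ τ hζ le_rfl) hφ fun p => hC _

end StoppedWalk

/-! ### Exponential bounds for walks with bounded jumps -/

section ExponentialBounds

/-- From exp v ≤ 1 + v + v² for |v| ≤ 1: for small θ the negative first-order term θμ outweighs
θ²C². -/
lemma exists_integral_exp_lt_one {F : Measure ℝ} [IsProbabilityMeasure F] {X : ℝ → ℝ}
    (hX : Measurable X) {C : ℝ} (hC : ∀ u, |X u| ≤ C) (hneg : ∫ u, X u ∂F < 0) :
    ∃ θ > 0, ∫ u, Real.exp (θ * X u) ∂F < 1 := by
  set μ := ∫ u, X u ∂F with hμ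
  have hC0 : 0 ≤ C := (abs_nonneg _).trans (hC 0)
  set θ := min (1 / (C + 1)) (-μ / (C ^ 2 + 1)) with hθ
  have hθ0 : 0 < θ := lt_min (by positivity) (div_pos (by linarith) (by positivity))
  have h1 : θ * C ≤ 1 := by
    have : θ * (C + 1) ≤ 1 := by
      rw [← le_div_iff₀ (by positivity)]
      exact min_le_left _ _
    linarith
  have h2 : θ * C ^ 2 < -μ := by
    have : θ * (C ^ 2 + 1) ≤ -μ := by
      rw [← le_div_iff₀ (by positivity)]
      exact min_le_right _ _
    linarith
  have hXi : Integrable X F := Integrable.of_bound hX.aestronglyMeasurable C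
    (Eventually.of_forall hC)
  refine ⟨θ, hθ0, ?_⟩
  have h3 : ∀ u, Real.exp (θ * X u) ≤ 1 + θ * X u + θ ^ 2 * C ^ 2 := fun u => by
    have h4 : |θ * X u| ≤ θ * C := by
      rw [abs_mul, abs_of_pos hθ0]
      gcongr
      exact hC u
    have h5 := (abs_le.1 (Real.abs_exp_sub_one_sub_id_le (h4.trans h1))).2
    have h6 : (θ * X u) ^ 2 ≤ (θ * C) ^ 2 := sq_le_sq' (by linarith [(abs_le.1 h4).1])
      (abs_le.1 h4).2
    nlinarith
  have hi : Integrable (fun u => 1 + θ * X u + θ ^ 2 * C ^ 2) F :=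
    ((integrable_const _).add (hXi.const_mul θ)).add (integrable_const _)
  calc ∫ u, Real.exp (θ * X u) ∂F ≤ ∫ u, (1 + θ * X u + θ ^ 2 * C ^ 2) ∂F :=
        integral_mono_of_nonneg (Eventually.of_forall fun u => (Real.exp_pos _).le) hi
          (Eventually.of_forall h3)
    _ = 1 + θ * μ + θ ^ 2 * C ^ 2 := by
        have hi2 : Integrable (fun u => 1 + θ * X u) F := (integrable_const _).add (hXi.const_mul θ)
        rw [integral_add hi2 (integrable_const _),
          integral_add (integrable_const _) (hXi.const_mul θ), integral_const_mul]
        simp [hμ]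
    _ < 1 := by nlinarith

lemma sum_range_ite_pow_le {ρ : ℝ} (h0 : 0 ≤ ρ) (h1 : ρ < 1) (N m : ℕ) :
    ∑ n ∈ Finset.range m, (if N ≤ n then ρ ^ n else 0) ≤ ρ ^ N / (1 - ρ) := by
  -- The exponent `max m N` also covers m < N, where the sum vanishes.
  have key : (1 - ρ) * ∑ n ∈ Finset.range m, (if N ≤ n then ρ ^ n else 0)
      ≤ ρ ^ N - ρ ^ max m N := by
    induction m with
    | zero => simp
    | succ m ih =>
      rw [Finset.sum_range_succ]
      split_ifs with h
      · rw [max_eq_left h] at ih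
        rw [max_eq_left (by omega), pow_succ]
        linarith
      · rw [max_eq_right (by omega)] at ih ⊢
        linarith
  rw [le_div_iff₀ (by linarith), mul_comm]
  exact key.trans (sub_le_self _ (pow_nonneg h0 _))

variable {Ω : Type*} [mΩ : MeasurableSpace Ω] {P : Measure Ω} [IsProbabilityMeasure P]
  {ξ : ℕ → Ω → ℝ} {F : Measure ℝ} [IsProbabilityMeasure F]

lemma abs_walk_le {X : ℕ → Ω → ℝ} {C : ℝ} (hC : ∀ i ω, |X i ω| ≤ C) (n : ℕ) (ω : Ω) :
    |walk X n ω| ≤ n * C := by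
  refine (Finset.abs_sum_le_sum_abs _ _).trans ?_
  calc ∑ i ∈ Finset.range n, |X i ω| ≤ ∑ _ ∈ Finset.range n, C :=
        Finset.sum_le_sum fun i _ => hC i ω
    _ = n * C := by simp

lemma integrable_exp_walk (hξ : ∀ i, Measurable (ξ i)) {ζ : ℝ → ℝ} (hζ : Measurable ζ) {C : ℝ}
    (hC : ∀ u, |ζ u| ≤ C) (θ : ℝ) (n : ℕ) :
    Integrable (fun ω => Real.exp (θ * walk (fun i ω => ζ (ξ i ω)) n ω)) P := by
  refine Integrable.of_bound (((measurable_walk (fun i => hζ.comp (hξ i)) n).const_mul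
    θ).exp).aestronglyMeasurable (Real.exp (|θ| * (n * C))) (Eventually.of_forall fun ω => ?_)
  rw [Real.norm_eq_abs, Real.abs_exp]
  refine Real.exp_le_exp.2 ((le_abs_self _).trans ?_)
  rw [abs_mul]
  exact mul_le_mul_of_nonneg_left (abs_walk_le (fun i ω => hC _) n ω) (abs_nonneg _)

lemma integral_exp_walk (hξ : ∀ i, Measurable (ξ i)) (hind : iIndepFun ξ P)
    (hmap : ∀ i, P.map (ξ i) = F) {ζ : ℝ → ℝ} (hζ : Measurable ζ) (θ : ℝ) (n : ℕ) :
    ∫ ω, Real.exp (θ * walk (fun i ω => ζ (ξ i ω)) n ω) ∂P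
      = (∫ u, Real.exp (θ * ζ u) ∂F) ^ n := by
  have h1 : iIndepFun (fun i => ζ ∘ ξ i) P := hind.comp (fun _ => ζ) fun _ => hζ
  have h2 := h1.mgf_sum (t := θ) (fun i => hζ.comp (hξ i)) (Finset.range n)
  have h3 : ∀ i, mgf (ζ ∘ ξ i) P θ = ∫ u, Real.exp (θ * ζ u) ∂F := fun i => by
    rw [← hmap i, integral_map (hξ i).aemeasurable
      ((hζ.const_mul θ).exp).aestronglyMeasurable]
    rfl
  rw [Finset.prod_congr rfl fun i _ => h3 i, Finset.prod_const, Finset.card_range] at h2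
  rw [← h2, mgf]
  congr 1
  funext ω
  simp [walk]

lemma walk_add_const (ζ : ℝ → ℝ) (b : ℝ) (n : ℕ) (ω : Ω) :
    walk (fun i ω => ζ (ξ i ω) + b) n ω = walk (fun i ω => ζ (ξ i ω)) n ω + b * n := by
  simp [walk, Finset.sum_add_distrib, mul_comm]

lemma walk_neg (X : ℕ → Ω → ℝ) (n : ℕ) (ω : Ω) :
    walk (fun i ω => -X i ω) n ω = -walk X n ω := by
  simp [walk]

lemma prob_exists_lt_walk_le (hξ : ∀ i, Measurable (ξ i)) (hind : iIndepFun ξ P)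
    (hmap : ∀ i, P.map (ξ i) = F) {ζ : ℝ → ℝ} (hζ : Measurable ζ) {C : ℝ}
    (hC : ∀ u, |ζ u| ≤ C) {θ : ℝ} (hθ : 0 < θ) (hρ : ∫ u, Real.exp (θ * ζ u) ∂F < 1) (y : ℝ) :
    P.real {ω | ∃ k, y < walk (fun i ω => ζ (ξ i ω)) k ω}
      ≤ Real.exp (-(θ * y)) / (1 - ∫ u, Real.exp (θ * ζ u) ∂F) := by
  set ρ := ∫ u, Real.exp (θ * ζ u) ∂F with hρd
  have hρ0 : 0 ≤ ρ := integral_nonneg fun u => (Real.exp_pos _).le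
  have h1 : ∀ k, P {ω | y < walk (fun i ω => ζ (ξ i ω)) k ω}
      ≤ ENNReal.ofReal (Real.exp (-(θ * y)) * ρ ^ k) := fun k => by
    have h2 := measure_ge_le_exp_mul_mgf (μ := P) y hθ.le (integrable_exp_walk hξ hζ hC θ k)
    rw [mgf, integral_exp_walk hξ hind hmap hζ, neg_mul, measureReal_def] at h2
    exact (measure_mono (fun ω (hω : y < _) => hω.le)).trans
      ((ENNReal.le_ofReal_iff_toReal_le (measure_ne_top _ _) (by positivity)).2 h2)
  have hsum : Summable fun k => Real.exp (-(θ * y)) * ρ ^ k :=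
    (summable_geometric_of_lt_one hρ0 hρ).mul_left _
  have h3 : P {ω | ∃ k, y < walk (fun i ω => ζ (ξ i ω)) k ω}
      ≤ ENNReal.ofReal (Real.exp (-(θ * y)) / (1 - ρ)) := by
    rw [ofPred_exists]
    refine (measure_iUnion_le _).trans ((ENNReal.tsum_le_tsum h1).trans ?_)
    rw [← ENNReal.ofReal_tsum_of_nonneg (fun k => by positivity) hsum, tsum_mul_left,
      tsum_geometric_of_lt_one hρ0 hρ, div_eq_mul_inv]
  exact ENNReal.toReal_le_of_le_ofReal (div_nonneg (Real.exp_pos _).le (by linarith)) h3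

lemma integrable_tail_comp {μ : Measure Ω} [IsFiniteMeasure μ] {f : Ω → ℝ} (hf : Measurable f) :
    Integrable (fun ω => tail F (f ω)) μ :=
  Integrable.of_bound (measurable_tail.comp hf).aestronglyMeasurable 1
    (Eventually.of_forall fun ω => by
      rw [Real.norm_eq_abs, abs_of_nonneg (tail_nonneg _)]
      exact tail_le_one _)

lemma setIntegral_exp_le {f : Ω → ℝ} (hf : Integrable (fun ω => Real.exp (f ω)) P) (A : Set Ω) :
    ∫ ω in A, Real.exp (f ω) ∂P ≤ ∫ ω, Real.exp (f ω) ∂P :=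
  setIntegral_le_integral hf (Eventually.of_forall fun _ => (Real.exp_pos _).le)

/-- For n < N the walk moves at most NK, which a long tail does not notice. For n ≥ N either S_n ≤
-bn, and the term is at most F̄(x + bn), or S_n > -bn; since the walk is still at most y, the tail
has then grown by at most exp(θ(S_n + bn + 1)). The exponential moment of S_n + bn is ρⁿ, so these
exceptional terms sum to a multiple of ρ^N F̄(x). -/
lemma sum_setIntegral_tail_le (hξ : ∀ i, Measurable (ξ i)) (hind : iIndepFun ξ P)
    (hmap : ∀ i, P.map (ξ i) = F) {ζ : ℝ → ℝ} (hζ : Measurable ζ) {K : ℝ} (hK0 : 0 ≤ K)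
    (hK : ∀ u, |ζ u| ≤ K) {b θ δ x y : ℝ} (hb : 0 ≤ b) (hδ : 0 ≤ δ) (hθ : 0 < θ)
    (hρ : ∫ u, Real.exp (θ * (ζ u + b)) ∂F < 1) (N m : ℕ)
    (h1 : tail F (x - N * K) ≤ (1 + δ) * tail F (x + b * N))
    (h2 : ∀ s, 0 ≤ s → s ≤ y → tail F (x - s) ≤ Real.exp (θ * (s + 1)) * tail F x)
    {A : ℕ → Set Ω} (hA : ∀ n, MeasurableSet (A n))
    (hAy : ∀ n, ∀ ω ∈ A n, walk (fun i ω => ζ (ξ i ω)) n ω ≤ y) (hy : 0 ≤ y) :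
    ∑ n ∈ Finset.range m, ∫ ω in A n, tail F (x - walk (fun i ω => ζ (ξ i ω)) n ω) ∂P
      ≤ (1 + δ) * ∑ n ∈ Finset.range m, P.real (A n) * tail F (x + b * n)
        + Real.exp θ * (∫ u, Real.exp (θ * (ζ u + b)) ∂F) ^ N
          / (1 - ∫ u, Real.exp (θ * (ζ u + b)) ∂F) * tail F x := by
  set ρ := ∫ u, Real.exp (θ * (ζ u + b)) ∂F with hρd
  have hρ0 : 0 ≤ ρ := integral_nonneg fun u => (Real.exp_pos _).le
  set S := walk fun i ω => ζ (ξ i ω) with hS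
  have hSm : ∀ n, Measurable (S n) := measurable_walk fun i => hζ.comp (hξ i)
  have hti : ∀ n, Integrable (fun ω => tail F (x - S n ω)) (P.restrict (A n)) := fun n =>
    integrable_tail_comp (measurable_const.sub (hSm n))
  have hC : ∀ u, |ζ u + b| ≤ K + b := fun u =>
    (abs_add_le _ _).trans (add_le_add (hK u) (abs_of_nonneg hb).le)
  have hexpi := fun n => integrable_exp_walk (P := P) hξ (hζ.add_const b) hC θ n
  have hexp := fun n => integral_exp_walk hξ hind hmap (hζ.add_const b) θ n
  simp only [walk_add_const] at hexpi hexp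
  rw [← hρd, ← hS] at hexp
  rw [← hS] at hexpi
  have hconst : ∀ n c, ∫ _ in A n, c ∂P = P.real (A n) * c := fun n c => by simp
  have hterm : ∀ n, ∫ ω in A n, tail F (x - S n ω) ∂P
      ≤ (1 + δ) * (P.real (A n) * tail F (x + b * n))
        + Real.exp θ * tail F x * (if N ≤ n then ρ ^ n else 0) := by
    intro n
    have ht := tail_nonneg (F := F) (x + b * n)
    split_ifs with hn
    · have hpt : ∀ ω ∈ A n, tail F (x - S n ω) ≤ tail F (x + b * n)
          + Real.exp θ * tail F x * Real.exp (θ * (S n ω + b * n)) := fun ω hω => by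
        have hx := tail_nonneg (F := F) x
        rcases le_or_gt (S n ω) (-(b * n)) with h | h
        · have h3 : tail F (x - S n ω) ≤ tail F (x + b * n) := tail_antitone (by linarith)
          exact h3.trans (le_add_of_nonneg_right (by positivity))
        · have h3 := h2 (max (S n ω) 0) (le_max_right _ _) (max_le (hAy n ω hω) hy)
          have h4 : tail F (x - S n ω) ≤ tail F (x - max (S n ω) 0) :=
            tail_antitone (by linarith [le_max_left (S n ω) 0])
          have h5 : max (S n ω) 0 ≤ S n ω + b * n :=
            max_le (le_add_of_nonneg_right (by positivity)) (by linarith)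
          calc tail F (x - S n ω) ≤ Real.exp (θ * (max (S n ω) 0 + 1)) * tail F x := h4.trans h3
            _ ≤ Real.exp (θ * (S n ω + b * n + 1)) * tail F x := by gcongr
            _ = Real.exp θ * tail F x * Real.exp (θ * (S n ω + b * n)) := by
                rw [mul_add, Real.exp_add, mul_one]; ring
            _ ≤ _ := le_add_of_nonneg_left ht
      have hi : Integrable (fun ω => Real.exp θ * tail F x * Real.exp (θ * (S n ω + b * n)))
          (P.restrict (A n)) := ((hexpi n).const_mul _).restrict
      calc ∫ ω in A n, tail F (x - S n ω) ∂P
          ≤ ∫ ω in A n, (tail F (x + b * n)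
            + Real.exp θ * tail F x * Real.exp (θ * (S n ω + b * n))) ∂P :=
            setIntegral_mono_on (hti n) ((integrable_const _).add hi) (hA n) hpt
        _ = P.real (A n) * tail F (x + b * n)
            + Real.exp θ * tail F x * ∫ ω in A n, Real.exp (θ * (S n ω + b * n)) ∂P := by
            rw [integral_add (integrable_const _) hi, hconst, integral_const_mul]
        _ ≤ (1 + δ) * (P.real (A n) * tail F (x + b * n)) + Real.exp θ * tail F x * ρ ^ n := by
            have h3 := setIntegral_exp_le (hexpi n) (A n)
            rw [hexp n] at h3
            have h4 : 0 ≤ P.real (A n) * tail F (x + b * n) := mul_nonneg measureReal_nonneg ht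
            refine add_le_add (by nlinarith) (mul_le_mul_of_nonneg_left h3 ?_)
            exact mul_nonneg (Real.exp_pos _).le (tail_nonneg _)
    · rw [mul_zero, add_zero]
      have hn' : (n : ℝ) ≤ N := Nat.cast_le.2 (by omega)
      calc ∫ ω in A n, tail F (x - S n ω) ∂P ≤ ∫ ω in A n, (1 + δ) * tail F (x + b * n) ∂P := by
            refine setIntegral_mono_on (hti n) (integrable_const _) (hA n) fun ω _ => ?_
            have h3 : S n ω ≤ N * K := ((le_abs_self _).trans
              (abs_walk_le (fun i ω => hK _) n ω)).trans (by gcongr)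
            calc tail F (x - S n ω) ≤ tail F (x - N * K) := tail_antitone (by linarith)
              _ ≤ (1 + δ) * tail F (x + b * N) := h1
              _ ≤ _ := by
                have h4 : tail F (x + b * N) ≤ tail F (x + b * n) :=
                  tail_antitone (by gcongr)
                gcongr
        _ = _ := by rw [hconst]; ring
  calc _ ≤ ∑ n ∈ Finset.range m, ((1 + δ) * (P.real (A n) * tail F (x + b * n))
        + Real.exp θ * tail F x * (if N ≤ n then ρ ^ n else 0)) :=
        Finset.sum_le_sum fun n _ => hterm n
    _ = (1 + δ) * ∑ n ∈ Finset.range m, P.real (A n) * tail F (x + b * n)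
        + Real.exp θ * tail F x * ∑ n ∈ Finset.range m, (if N ≤ n then ρ ^ n else 0) := by
        rw [Finset.sum_add_distrib, Finset.mul_sum, Finset.mul_sum]
    _ ≤ _ := by
        have h3 := mul_le_mul_of_nonneg_left (sum_range_ite_pow_le hρ0 hρ N m)
          (mul_nonneg (Real.exp_pos θ).le (tail_nonneg (F := F) x))
        have h4 : Real.exp θ * tail F x * (ρ ^ N / (1 - ρ))
          = Real.exp θ * ρ ^ N / (1 - ρ) * tail F x := by ring
        linarith

/-- The mirror argument: a walk far below -bn is rare because -(S_n + bn) has a geometrically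
decaying exponential moment. No cap on the walk is needed, since F̄(x + bn) ≤ F̄(x) bounds the loss.
-/
lemma le_sum_setIntegral_tail (hξ : ∀ i, Measurable (ξ i)) (hind : iIndepFun ξ P)
    (hmap : ∀ i, P.map (ξ i) = F) {ζ : ℝ → ℝ} (hζ : Measurable ζ) {K : ℝ} (hK0 : 0 ≤ K)
    (hK : ∀ u, |ζ u| ≤ K) {b θ δ x : ℝ} (hb : 0 ≤ b) (hδ : 0 ≤ δ)
    (hρ : ∫ u, Real.exp (θ * -(ζ u + b)) ∂F < 1) (hθ : 0 < θ) (N m : ℕ)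
    (h1 : tail F x ≤ (1 + δ) * tail F (x + N * K))
    {A : ℕ → Set Ω} (hA : ∀ n, MeasurableSet (A n)) :
    (∑ n ∈ Finset.range m, P.real (A n) * tail F (x + b * n)) / (1 + δ)
        - (∫ u, Real.exp (θ * -(ζ u + b)) ∂F) ^ N
          / (1 - ∫ u, Real.exp (θ * -(ζ u + b)) ∂F) * tail F x
      ≤ ∑ n ∈ Finset.range m, ∫ ω in A n, tail F (x - walk (fun i ω => ζ (ξ i ω)) n ω) ∂P := by
  set ρ := ∫ u, Real.exp (θ * -(ζ u + b)) ∂F with hρd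
  have hρ0 : 0 ≤ ρ := integral_nonneg fun u => (Real.exp_pos _).le
  set S := walk fun i ω => ζ (ξ i ω) with hS
  have hSm : ∀ n, Measurable (S n) := measurable_walk fun i => hζ.comp (hξ i)
  have hti : ∀ n, Integrable (fun ω => tail F (x - S n ω)) (P.restrict (A n)) := fun n =>
    integrable_tail_comp (measurable_const.sub (hSm n))
  have hC : ∀ u, |-(ζ u + b)| ≤ K + b := fun u => by
    rw [abs_neg]
    exact (abs_add_le _ _).trans (add_le_add (hK u) (abs_of_nonneg hb).le)
  have hexpi := fun n => integrable_exp_walk (P := P) hξ (hζ.add_const b).neg hC θ n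
  have hexp := fun n => integral_exp_walk hξ hind hmap (hζ.add_const b).neg θ n
  simp only [Pi.neg_apply, walk_neg, walk_add_const] at hexpi hexp
  rw [← hρd, ← hS] at hexp
  rw [← hS] at hexpi
  have hconst : ∀ n c, ∫ _ in A n, c ∂P = P.real (A n) * c := fun n c => by simp
  have hterm : ∀ n, (P.real (A n) * tail F (x + b * n)) / (1 + δ)
      - tail F x * (if N ≤ n then ρ ^ n else 0) ≤ ∫ ω in A n, tail F (x - S n ω) ∂P := by
    intro n
    have ht := tail_nonneg (F := F) (x + b * n)
    have hx := tail_nonneg (F := F) x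
    have hbn : 0 ≤ b * n := by positivity
    split_ifs with hn
    · have hpt : ∀ ω ∈ A n, tail F (x + b * n) - tail F x * Real.exp (θ * -(S n ω + b * n))
          ≤ tail F (x - S n ω) := fun ω hω => by
        rcases le_or_gt (-(b * n)) (S n ω) with h | h
        · have h3 : tail F (x + b * n) ≤ tail F (x - S n ω) := tail_antitone (by linarith)
          exact (sub_le_self _ (by positivity)).trans h3
        -- In this case the exponential is at least 1, so the left-hand side is nonpositive.
        · have h3 : tail F (x + b * n) ≤ tail F x := tail_antitone (by linarith)
          have h4 : 1 ≤ Real.exp (θ * -(S n ω + b * n)) :=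
            Real.one_le_exp (mul_nonneg hθ.le (by linarith))
          have h5 := tail_nonneg (F := F) (x - S n ω)
          nlinarith
      have hi : Integrable (fun ω => tail F x * Real.exp (θ * -(S n ω + b * n)))
          (P.restrict (A n)) := ((hexpi n).const_mul _).restrict
      have h3 := setIntegral_exp_le (hexpi n) (A n)
      rw [hexp n] at h3
      have h4 := mul_le_mul_of_nonneg_left h3 hx
      calc (P.real (A n) * tail F (x + b * n)) / (1 + δ) - tail F x * ρ ^ n
          ≤ P.real (A n) * tail F (x + b * n)
            - tail F x * ∫ ω in A n, Real.exp (θ * -(S n ω + b * n)) ∂P := by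
            have h5 := div_le_self (mul_nonneg (measureReal_nonneg (μ := P) (s := A n)) ht)
              (show 1 ≤ 1 + δ by linarith)
            linarith
        _ = ∫ ω in A n, (tail F (x + b * n)
            - tail F x * Real.exp (θ * -(S n ω + b * n))) ∂P := by
            rw [integral_sub (integrable_const _) hi, hconst, integral_const_mul]
        _ ≤ _ := setIntegral_mono_on ((integrable_const _).sub hi) (hti n) (hA n) hpt
    · rw [mul_zero, sub_zero]
      have hn' : (n : ℝ) ≤ N := Nat.cast_le.2 (by omega)
      calc (P.real (A n) * tail F (x + b * n)) / (1 + δ)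
          = ∫ ω in A n, tail F (x + b * n) / (1 + δ) ∂P := by rw [hconst]; ring
        _ ≤ _ := by
            refine setIntegral_mono_on (integrable_const _) (hti n) (hA n) fun ω _ => ?_
            have h3 : -(N * K) ≤ S n ω := by
              have h4 := (abs_le.1 (abs_walk_le (X := fun i ω => ζ (ξ i ω))
                (fun i ω => hK _) n ω)).1
              have h5 : (n : ℝ) * K ≤ N * K := by gcongr
              exact (neg_le_neg h5).trans h4
            rw [div_le_iff₀ (by linarith)]
            calc tail F (x + b * n) ≤ tail F x := tail_antitone (by linarith)
              _ ≤ (1 + δ) * tail F (x + N * K) := h1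
              _ ≤ (1 + δ) * tail F (x - S n ω) := by
                have h4 : tail F (x + N * K) ≤ tail F (x - S n ω) :=
                  tail_antitone (by linarith)
                gcongr
              _ = _ := mul_comm _ _
  calc _ ≤ ∑ n ∈ Finset.range m, ((P.real (A n) * tail F (x + b * n)) / (1 + δ)
        - tail F x * (if N ≤ n then ρ ^ n else 0)) := by
        rw [Finset.sum_sub_distrib, Finset.sum_div, ← Finset.mul_sum]
        have h3 := mul_le_mul_of_nonneg_left (sum_range_ite_pow_le hρ0 hρ N m)
          (tail_nonneg (F := F) x)
        have h4 : tail F x * (ρ ^ N / (1 - ρ)) = ρ ^ N / (1 - ρ) * tail F x := by ring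
        linarith
    _ ≤ _ := Finset.sum_le_sum fun n _ => hterm n

end ExponentialBounds

/-! ### One-step drift of the integrated tail -/

section Drift

variable {F : Measure ℝ} [IsProbabilityMeasure F]

lemma abs_tailIntegral_max_le (hm : Integrable (fun x : ℝ => x) F) (z y : ℝ) :
    |tailIntegral F (max y z)| ≤ tailIntegral F z := by
  rw [abs_of_nonneg (tailIntegral_nonneg _)]
  exact tailIntegral_antitone hm (le_max_right _ _)

lemma antitone_tailIntegral_max (hm : Integrable (fun x : ℝ => x) F) (z : ℝ) :
    Antitone fun y => tailIntegral F (max y z) := fun _ _ h =>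
  tailIntegral_antitone hm (max_le_max_right _ h)

lemma integrable_tailIntegral_max (hm : Integrable (fun x : ℝ => x) F) (z : ℝ) {ζ : ℝ → ℝ}
    (hζ : Measurable ζ) (y : ℝ) : Integrable (fun u => tailIntegral F (max (y - ζ u) z)) F :=
  Integrable.of_bound ((antitone_tailIntegral_max hm z).measurable.comp
    (measurable_const.sub hζ)).aestronglyMeasurable (tailIntegral F z)
    (Eventually.of_forall fun _ => abs_tailIntegral_max_le hm z _)

/-- Convexity alone, so jumps need no lower bound. The bound ζ ≤ K with y ≥ z + K only ensures that
the truncation at z is inactive after the jump. -/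
lemma le_drift_tailIntegral (hm : Integrable (fun x : ℝ => x) F) {ζ : ℝ → ℝ} (hζ : Measurable ζ)
    (hi : Integrable ζ F) {K y z : ℝ} (hK0 : 0 ≤ K) (hK : ∀ u, ζ u ≤ K) (hy : z + K ≤ y) :
    (∫ u, ζ u ∂F) * tail F y
      ≤ ∫ u, tailIntegral F (max (y - ζ u) z) ∂F - tailIntegral F (max y z) := by
  have h1 := integrable_tailIntegral_max hm z hζ y
  have h2 := integral_mono (hi.mul_const (tail F y)) (h1.sub (integrable_const
    (tailIntegral F (max y z)))) fun u => by
      simp only [Pi.sub_apply]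
      rw [max_eq_left (by linarith [hK u]), max_eq_left (by linarith)]
      exact mul_tail_le_tailIntegral_sub hm y (ζ u)
  simp only [Pi.sub_apply] at h2
  rw [integral_mul_const, integral_sub h1 (integrable_const _)] at h2
  simpa using h2

/-- The reverse inequality replaces F̄(y) by F̄(y - ζ); for |ζ| ≤ K long-tailedness bounds the
relative change by δ, hence the error Kδ. -/
lemma drift_tailIntegral_le (hm : Integrable (fun x : ℝ => x) F) {ζ : ℝ → ℝ} (hζ : Measurable ζ)
    {K y z δ : ℝ} (hK : ∀ u, |ζ u| ≤ K) (hy : z + K ≤ y) (hδ : 0 ≤ δ)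
    (h1 : tail F (y - K) ≤ (1 + δ) * tail F y) (h2 : tail F y ≤ (1 + δ) * tail F (y + K)) :
    ∫ u, tailIntegral F (max (y - ζ u) z) ∂F - tailIntegral F (max y z)
      ≤ (∫ u, ζ u ∂F + K * δ) * tail F y := by
  have hK0 : 0 ≤ K := (abs_nonneg _).trans (hK 0)
  have hi : Integrable ζ F := Integrable.of_bound hζ.aestronglyMeasurable K
    (Eventually.of_forall hK)
  have h3 := integrable_tailIntegral_max hm z hζ y
  have h4 := integral_mono (h3.sub (integrable_const (tailIntegral F (max y z))))
    ((hi.add (integrable_const (K * δ))).mul_const (tail F y)) fun u => by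
      obtain ⟨hu1, hu2⟩ := abs_le.1 (hK u)
      simp only [Pi.sub_apply, Pi.add_apply]
      rw [max_eq_left (by linarith), max_eq_left (by linarith)]
      refine (tailIntegral_sub_le_mul_tail hm y (ζ u)).trans ?_
      have hT := tail_nonneg (F := F) y
      rcases le_total 0 (ζ u) with h | h
      · have h5 : tail F (y - ζ u) ≤ (1 + δ) * tail F y :=
          (tail_antitone (by linarith)).trans h1
        have h6 := mul_le_mul_of_nonneg_left h5 h
        have h7 : ζ u * (δ * tail F y) ≤ K * (δ * tail F y) :=
          mul_le_mul_of_nonneg_right hu2 (mul_nonneg hδ hT)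
        linarith
      · have h5 : tail F (y + K) ≤ tail F (y - ζ u) := tail_antitone (by linarith)
        have h6 : tail F y - tail F (y - ζ u) ≤ δ * tail F y := by
          have h8 : tail F (y + K) ≤ tail F y := tail_antitone (by linarith)
          have h9 := mul_le_mul_of_nonneg_left h8 hδ
          linarith
        have h7 := mul_le_mul_of_nonneg_left h6 (neg_nonneg.2 h)
        have h8 : -ζ u * (δ * tail F y) ≤ K * (δ * tail F y) :=
          mul_le_mul_of_nonneg_right (by linarith) (mul_nonneg hδ hT)
        linarith
  simp only [Pi.sub_apply, Pi.add_apply] at h4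
  rw [integral_mul_const, integral_sub h3 (integrable_const _),
    integral_add hi (integrable_const _)] at h4
  simpa using h4

end Drift

/-! ### From Dynkin's formula to exceedance probabilities -/

section Comparison

variable {Ω : Type*} [mΩ : MeasurableSpace Ω] {P : Measure Ω} [IsProbabilityMeasure P]
  {ξ : ℕ → Ω → ℝ} {τ : Ω → ℕ∞} {F : Measure ℝ} [IsProbabilityMeasure F]

lemma lt_walkMax_iff {x : ℝ} {ω : Ω} :
    (x : EReal) < walkMax ξ τ ω ↔ ∃ n : ℕ, (n : ℕ∞) ≤ τ ω ∧ x < walk ξ n ω := by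
  simp [walkMax, lt_iSup_iff]

lemma measurable_stoppedWalk (hξ : ∀ i, Measurable (ξ i)) {A : ℕ → Set Ω}
    (hA : ∀ n, MeasurableSet (A n)) {ζ : ℝ → ℝ} (hζ : Measurable ζ) (m : ℕ) :
    Measurable (stoppedWalk A (fun i ω => ζ (ξ i ω)) m) :=
  Finset.measurable_fun_sum _ fun i _ => (hζ.comp (hξ i)).indicator (hA i)

lemma not_alive_of_lt_stoppedWalk {X Y : ℕ → Ω → ℝ} {x y : ℝ} {m : ℕ} {ω : Ω}
    (h : x < stoppedWalk (aliveSet τ X x Y y) X m ω) : ω ∉ aliveSet τ X x Y y m := by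
  obtain ⟨k, hk, h1, -⟩ := exists_stoppedWalk_eq_walk (aliveSet_antitone τ X x Y y) X m ω
  intro h2
  rw [h1] at h
  exact absurd (h2.2 k hk).1 (not_le.2 h)

/-- Unless the Y-walk ever exceeds y, the larger X-walk is alive at all times before its first
passage above x, which occurs no later than τ. Hence the stopped X-walk itself sits above x from
that time on. -/
lemma prob_lt_walkMax_le {X Y : ℕ → Ω → ℝ} (hξX : ∀ i ω, ξ i ω ≤ X i ω) {x y B : ℝ}
    (hB : ∀ m, P.real {ω | x < stoppedWalk (aliveSet τ X x Y y) X m ω} ≤ B) :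
    P.real {ω | (x : EReal) < walkMax ξ τ ω} ≤ B + P.real {ω | ∃ k, y < walk Y k ω} := by
  set E : ℕ → Set Ω := fun m => {ω | x < stoppedWalk (aliveSet τ X x Y y) X m ω} with hE
  have hsub : {ω | (x : EReal) < walkMax ξ τ ω} ⊆ (⋃ m, E m) ∪ {ω | ∃ k, y < walk Y k ω} := by
    intro ω hω
    obtain ⟨n, hn, hxn⟩ := lt_walkMax_iff.1 hω
    by_cases hY : ∃ k, y < walk Y k ω
    · exact Or.inr hY
    · push Not at hY
      left
      have hex : ∃ k, x < walk X k ω := ⟨n, hxn.trans_le (walk_mono hξX n ω)⟩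
      classical
      have hk := Nat.find_spec hex
      have hkn : Nat.find hex ≤ n := Nat.find_min' hex (hxn.trans_le (walk_mono hξX n ω))
      refine mem_iUnion.2 ⟨Nat.find hex, ?_⟩
      simp only [hE, mem_ofPred_eq]
      rw [stoppedWalk_eq_walk]
      · exact hk
      · intro i hi
        refine ⟨lt_of_lt_of_le (Nat.cast_lt.2 (hi.trans_le hkn)) hn, fun j hj => ⟨?_, hY j⟩⟩
        exact not_lt.1 (Nat.find_min hex (hj.trans_lt hi))
  -- Once above x the stopped walk is no longer alive and stays frozen there.
  have hmono : Monotone E := monotone_nat_of_le_succ fun m ω hω => by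
    have h1 : x < stoppedWalk (aliveSet τ X x Y y) X m ω := hω
    have h2 := not_alive_of_lt_stoppedWalk h1
    simpa only [hE, mem_ofPred_eq, stoppedWalk_succ, indicator_of_notMem h2, add_zero] using h1
  have hU : P.real (⋃ m, E m) ≤ B := by
    have h1 := tendsto_measure_iUnion_atTop (μ := P) hmono
    have h2 := (ENNReal.tendsto_toReal (measure_ne_top P _)).comp h1
    exact le_of_tendsto h2 (Eventually.of_forall hB)
  calc P.real {ω | (x : EReal) < walkMax ξ τ ω}
      ≤ P.real ((⋃ m, E m) ∪ {ω | ∃ k, y < walk Y k ω}) := measureReal_mono hsub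
    _ ≤ P.real (⋃ m, E m) + P.real {ω | ∃ k, y < walk Y k ω} := measureReal_union_le _ _
    _ ≤ _ := by gcongr

/-- The stopped walk is S_k with k = 0 or the walk alive at k - 1; then τ > k - 1, that is k ≤ τ. -/
lemma prob_stoppedWalk_le_prob_walkMax {Y : ℕ → Ω → ℝ} {x y : ℝ} (m : ℕ) :
    P.real {ω | x < stoppedWalk (aliveSet τ ξ x Y y) ξ m ω}
      ≤ P.real {ω | (x : EReal) < walkMax ξ τ ω} := by
  refine measureReal_mono fun ω hω => lt_walkMax_iff.2 ?_
  obtain ⟨k, -, h1, h2⟩ := exists_stoppedWalk_eq_walk (aliveSet_antitone τ ξ x Y y) ξ m ω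
  refine ⟨k, ?_, by rwa [← h1]⟩
  rcases k with _ | k
  · simp
  · have h3 := (h2 k (Nat.lt_succ_self k)).1
    rw [Nat.cast_succ]
    exact Order.add_one_le_of_lt h3

lemma prob_lt_le_prob_aliveSet_add {Y : ℕ → Ω → ℝ} {x y : ℝ} (n : ℕ) :
    P.real {ω | (n : ℕ∞) < τ ω} ≤ P.real (aliveSet τ ξ x Y y n)
      + (P.real {ω | (x : EReal) < walkMax ξ τ ω} + P.real {ω | ∃ k, y < walk Y k ω}) := by
  have hsub : {ω | (n : ℕ∞) < τ ω} ⊆ aliveSet τ ξ x Y y n ∪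
      ({ω | (x : EReal) < walkMax ξ τ ω} ∪ {ω | ∃ k, y < walk Y k ω}) := by
    intro ω hω
    have hω : (n : ℕ∞) < τ ω := hω
    by_cases hY : ∃ k, y < walk Y k ω
    · exact Or.inr (Or.inr hY)
    by_cases hM : (x : EReal) < walkMax ξ τ ω
    · exact Or.inr (Or.inl hM)
    · push Not at hY
      refine Or.inl ⟨hω, fun k hk => ⟨?_, hY k⟩⟩
      by_contra hcon
      exact hM (lt_walkMax_iff.2 ⟨k, (Nat.cast_le.2 hk).trans hω.le, not_le.1 hcon⟩)
  refine (measureReal_mono hsub).trans ((measureReal_union_le _ _).trans ?_)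
  gcongr
  exact measureReal_union_le _ _

/-- The supermartingale bound for the probability of exceeding a level. -/
lemma prob_stoppedWalk_le (hm : Integrable (fun x : ℝ => x) F)
    (hξ : ∀ i, Measurable (ξ i)) (hmap : ∀ i, P.map (ξ i) = F) (hτ : Measurable τ)
    (hfut : NotDependOnFuture P ξ τ) {K : ℝ} (hK : 0 ≤ K) {h : ℝ → ℝ} (hhm : Measurable h) {C : ℝ}
    (hhC : ∀ y, |h y| ≤ C) (hhneg : ∀ y < 0, h y = 1) (hanti : AntitoneOn h (Ici 0))
    (hdrift : ∀ y, 0 ≤ y → ∫ u, h (y - max u (-K)) ∂F ≤ h y) {c y₂ x : ℝ} (hc : 0 ≤ c)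
    (hy₂ : 0 ≤ y₂) (hhc : ∀ y, y₂ ≤ y → h y = c * tailIntegral F y) (hx : y₂ + K ≤ x / 2)
    (m : ℕ) :
    (1 - c * tailIntegral F y₂) * P.real {ω | x < stoppedWalk
        (aliveSet τ (fun i ω => max (ξ i ω) (-K)) x (fun i ω => max (min (ξ i ω) K) (-K)) (x / 2))
        (fun i ω => max (ξ i ω) (-K)) m ω}
      ≤ c * -(∫ u, max (min u K) (-K) ∂F) * ∑ n ∈ Finset.range m, ∫ ω in
        aliveSet τ (fun i ω => max (ξ i ω) (-K)) x (fun i ω => max (min (ξ i ω) K) (-K)) (x / 2) n,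
          tail F (x - walk (fun i ω => max (min (ξ i ω) K) (-K)) n ω) ∂P := by
  set ζ₁ : ℝ → ℝ := fun u => max u (-K) with hζ₁
  set ζ₃ : ℝ → ℝ := fun u => max (min u K) (-K) with hζ₃
  have hm1 : Measurable ζ₁ := by fun_prop
  have hm3 : Measurable ζ₃ := by fun_prop
  set A := aliveSet τ (fun i ω => ζ₁ (ξ i ω)) x (fun i ω => ζ₃ (ξ i ω)) (x / 2) with hA
  have hAanti : Antitone A := aliveSet_antitone _ _ _ _ _
  have hAp : ∀ n, MeasurableSet[past ξ τ n] (A n) :=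
    measurableSet_past_aliveSet ξ τ hm1 hm3 x (x / 2)
  have hAm : ∀ n, MeasurableSet (A n) := fun n => past_le hξ hτ n _ (hAp n)
  set W₁ := stoppedWalk A (fun i ω => ζ₁ (ξ i ω)) m with hW₁
  set W₃ := stoppedWalk A (fun i ω => ζ₃ (ξ i ω)) m with hW₃
  have hW₁m : Measurable W₁ := measurable_stoppedWalk hξ hAm hm1 m
  have hW₃m : Measurable W₃ := measurable_stoppedWalk hξ hAm hm3 m
  have h31 : ∀ ω, W₃ ω ≤ W₁ ω := stoppedWalk_mono
    (fun i ω => max_le_max_right _ (min_le_left _ _)) m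
  set g : ℝ → ℝ := fun y => tailIntegral F (max y y₂) with hg
  have hgm : Measurable g := (antitone_tailIntegral_max hm y₂).measurable
  have hgC : ∀ y, |g y| ≤ tailIntegral F y₂ := abs_tailIntegral_max_le hm y₂
  have hxx : y₂ ≤ x := by linarith
  have hK3 : ∀ u, |ζ₃ u| ≤ K := fun u =>
    abs_le.2 ⟨le_max_right _ _, max_le (min_le_right _ _) (by linarith)⟩
  have e1 := integral_comp_stoppedWalk hξ hmap hτ hfut hAanti hAp hm1 hhm hhC x m
  have e2 := integral_comp_stoppedWalk hξ hmap hτ hfut hAanti hAp hm3 hgm hgC x m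
  -- While alive the argument x - S_n is nonnegative, where the Lyapunov drift is nonpositive.
  have hs1 : ∑ n ∈ Finset.range m, ∫ ω in A n, (∫ u, h (x - walk (fun i ω => ζ₁ (ξ i ω)) n ω - ζ₁ u)
      ∂F - h (x - walk (fun i ω => ζ₁ (ξ i ω)) n ω)) ∂P ≤ 0 :=
    Finset.sum_nonpos fun n _ => setIntegral_nonpos (hAm n) fun ω hω => by
      have h1 : walk (fun i ω => ζ₁ (ξ i ω)) n ω ≤ x := (hω.2 n le_rfl).1
      exact sub_nonpos.2 (hdrift _ (by linarith))
  have hs2 : -(-(∫ u, ζ₃ u ∂F) * ∑ n ∈ Finset.range m,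
      ∫ ω in A n, tail F (x - walk (fun i ω => ζ₃ (ξ i ω)) n ω) ∂P)
      ≤ ∑ n ∈ Finset.range m, ∫ ω in A n, (∫ u, g (x - walk (fun i ω => ζ₃ (ξ i ω)) n ω - ζ₃ u)
      ∂F - g (x - walk (fun i ω => ζ₃ (ξ i ω)) n ω)) ∂P := by
    rw [neg_mul, neg_neg, Finset.mul_sum]
    refine Finset.sum_le_sum fun n _ => ?_
    rw [← integral_const_mul]
    have hSm : Measurable (walk (fun i ω => ζ₃ (ξ i ω)) n) :=
      measurable_walk (fun i => hm3.comp (hξ i)) n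
    have hφ : Measurable fun p : ℝ × ℝ => g (x - p.1 - ζ₃ p.2) :=
      hgm.comp ((measurable_const.sub measurable_fst).sub (hm3.comp measurable_snd))
    have i1 : Integrable (fun ω => ∫ u, g (x - walk (fun i ω => ζ₃ (ξ i ω)) n ω - ζ₃ u) ∂F)
        (P.restrict (A n)) := by
      refine Integrable.of_bound ((hφ.stronglyMeasurable.integral_prod_right').measurable.comp
        hSm).aestronglyMeasurable (tailIntegral F y₂) (Eventually.of_forall fun ω => ?_)
      refine (norm_integral_le_of_norm_le_const (Eventually.of_forall fun u => hgC _)).trans ?_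
      simp
    have i2 : Integrable (fun ω => g (x - walk (fun i ω => ζ₃ (ξ i ω)) n ω))
        (P.restrict (A n)) :=
      Integrable.of_bound (hgm.comp (measurable_const.sub hSm)).aestronglyMeasurable
        (tailIntegral F y₂) (Eventually.of_forall fun ω => hgC _)
    refine setIntegral_mono_on ((integrable_tail_comp (measurable_const.sub hSm)).const_mul _)
      (i1.sub i2) (hAm n) fun ω hω => ?_
    have h1 : walk (fun i ω => ζ₃ (ξ i ω)) n ω ≤ x / 2 := (hω.2 n le_rfl).2
    exact le_drift_tailIntegral hm hm3 (Integrable.of_bound hm3.aestronglyMeasurable K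
      (Eventually.of_forall hK3)) hK (fun u => (le_abs_self _).trans (hK3 u)) (by linarith)
  -- After crossing, h = 1 and the subtracted term is at most cG(y₂). Otherwise monotonicity of h
  -- moves the argument up to at least y₂, where h = cG, and the clamped walk lies below the walk
  -- truncated only from below.
  have hpt : ∀ ω, (1 - c * tailIntegral F y₂) * {ω | x < W₁ ω}.indicator 1 ω
      + c * g (x - W₃ ω) ≤ h (x - W₁ ω) := by
    intro ω
    have h1 : g (x - W₃ ω) ≤ g (x - W₁ ω) :=
      antitone_tailIntegral_max hm y₂ (by linarith [h31 ω])
    have h2 := mul_le_mul_of_nonneg_left h1 hc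
    by_cases hω : x < W₁ ω
    · rw [indicator_of_mem (show ω ∈ {ω | x < W₁ ω} from hω), hhneg _ (by linarith)]
      have h3 : g (x - W₁ ω) = tailIntegral F y₂ := by
        simp only [hg]
        rw [max_eq_right (by linarith)]
      rw [h3] at h2
      simp only [Pi.one_apply]
      linarith
    · rw [indicator_of_notMem (show ω ∉ {ω | x < W₁ ω} from hω), mul_zero, zero_add]
      refine h2.trans ?_
      simp only [hg]
      rw [← hhc _ (le_max_right _ _)]
      exact hanti (by simp only [mem_Ici]; linarith) (hy₂.trans (le_max_right _ _))
        (le_max_left _ _)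
  have hset : MeasurableSet {ω | x < W₁ ω} := measurableSet_lt measurable_const hW₁m
  have j1 : Integrable (fun ω => (1 - c * tailIntegral F y₂)
      * {ω | x < W₁ ω}.indicator (1 : Ω → ℝ) ω) P :=
    ((integrable_const (1 : ℝ)).indicator hset).const_mul _
  have j2 : Integrable (fun ω => c * g (x - W₃ ω)) P :=
    (Integrable.of_bound (hgm.comp (measurable_const.sub hW₃m)).aestronglyMeasurable
      (tailIntegral F y₂) (Eventually.of_forall fun ω => hgC _)).const_mul _
  have j3 : Integrable (fun ω => h (x - W₁ ω)) P :=
    Integrable.of_bound (hhm.comp (measurable_const.sub hW₁m)).aestronglyMeasurable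
      C (Eventually.of_forall fun ω => hhC _)
  have h4 := integral_mono (j1.add j2) j3 hpt
  simp only [Pi.add_apply] at h4
  rw [integral_add j1 j2, integral_const_mul, integral_const_mul, integral_indicator_one hset,
    e1, e2] at h4
  have h5 : h x = c * g x := by
    rw [hhc x hxx]
    simp only [hg]
    rw [max_eq_left hxx]
  have h6 := mul_le_mul_of_nonneg_left hs2 hc
  rw [mul_add] at h4
  linarith

/-- The submartingale bound for the probability of exceeding a level. -/
lemma mul_sum_setIntegral_tail_le_prob (hm : Integrable (fun x : ℝ => x) F)
    (hξ : ∀ i, Measurable (ξ i)) (hmap : ∀ i, P.map (ξ i) = F) (hτ : Measurable τ)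
    (hfut : NotDependOnFuture P ξ τ) {K : ℝ} (hK : 0 ≤ K) {δ x : ℝ} (hδ : 0 ≤ δ)
    (hx : K ≤ x / 2) (h1 : ∀ y, x / 2 ≤ y → tail F (y - K) ≤ (1 + δ) * tail F y)
    (hneg : ∫ u, min u K ∂F ≤ 0) (m : ℕ) :
    (-(∫ u, max (min u K) (-K) ∂F) - K * δ) * ∑ n ∈ Finset.range m, ∫ ω in
        aliveSet τ ξ x (fun i ω => max (min (ξ i ω) K) (-K)) (x / 2) n,
          tail F (x - walk (fun i ω => max (min (ξ i ω) K) (-K)) n ω) ∂P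
      ≤ -(∫ u, min u K ∂F) * P.real {ω | (x : EReal) < walkMax ξ τ ω} := by
  set ζ₂ : ℝ → ℝ := fun u => min u K with hζ₂
  set ζ₃ : ℝ → ℝ := fun u => max (min u K) (-K) with hζ₃
  have hm2 : Measurable ζ₂ := by fun_prop
  have hm3 : Measurable ζ₃ := by fun_prop
  set A := aliveSet τ ξ x (fun i ω => ζ₃ (ξ i ω)) (x / 2) with hA
  have hAanti : Antitone A := aliveSet_antitone _ _ _ _ _
  have hAp : ∀ n, MeasurableSet[past ξ τ n] (A n) :=
    measurableSet_past_aliveSet ξ τ measurable_id hm3 x (x / 2)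
  have hAm : ∀ n, MeasurableSet (A n) := fun n => past_le hξ hτ n _ (hAp n)
  set W := stoppedWalk A ξ m with hW
  set W₂ := stoppedWalk A (fun i ω => ζ₂ (ξ i ω)) m with hW₂
  set W₃ := stoppedWalk A (fun i ω => ζ₃ (ξ i ω)) m with hW₃
  set S := walk ξ with hS
  set S₂ := walk (fun i ω => ζ₂ (ξ i ω)) with hS₂
  set S₃ := walk (fun i ω => ζ₃ (ξ i ω)) with hS₃
  have hSm : ∀ n, Measurable (S n) := measurable_walk hξ
  have hS₂m : ∀ n, Measurable (S₂ n) := measurable_walk fun i => hm2.comp (hξ i)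
  have hS₃m : ∀ n, Measurable (S₃ n) := measurable_walk fun i => hm3.comp (hξ i)
  have hWm : Measurable W := measurable_stoppedWalk hξ hAm measurable_id m
  have hW₂m : Measurable W₂ := measurable_stoppedWalk hξ hAm hm2 m
  have hW₃m : Measurable W₃ := measurable_stoppedWalk hξ hAm hm3 m
  have h23 : ∀ ω, W₂ ω ≤ W₃ ω := stoppedWalk_mono (fun i ω => le_max_left _ _) m
  have hS23 : ∀ n ω, S₂ n ω ≤ S₃ n ω := walk_mono fun i ω => le_max_left _ _
  have hS2 : ∀ n ω, S₂ n ω ≤ S n ω := walk_mono fun i ω => min_le_left _ _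
  set g : ℝ → ℝ := fun y => tailIntegral F (max y 0) with hg
  have hgm : Measurable g := (antitone_tailIntegral_max hm 0).measurable
  have hgC : ∀ y, |g y| ≤ tailIntegral F 0 := abs_tailIntegral_max_le hm 0
  have hK3 : ∀ u, |ζ₃ u| ≤ K := fun u =>
    abs_le.2 ⟨le_max_right _ _, max_le (min_le_right _ _) (by linarith)⟩
  have hi2 : Integrable ζ₂ F := by
    exact hm.inf (integrable_const K)
  -- Applied to f, Dynkin's formula decomposes the crossing probability by the time of crossing: the
  -- drift of f at a nonnegative level y is F̄(y).
  set f : ℝ → ℝ := (Iio 0).indicator 1 with hf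
  have hfm : Measurable f := measurable_one.indicator measurableSet_Iio
  have hfC : ∀ y, |f y| ≤ 1 := fun y => by
    by_cases h : y < 0 <;> simp [hf, h]
  have e1 := integral_comp_stoppedWalk hξ hmap hτ hfut hAanti hAp measurable_id hfm hfC x m
  have e2 := integral_comp_stoppedWalk hξ hmap hτ hfut hAanti hAp hm2 hgm hgC x m
  have e3 := integral_comp_stoppedWalk hξ hmap hτ hfut hAanti hAp hm3 hgm hgC x m
  simp only [id] at e1
  rw [← hS₂, ← hW₂] at e2
  rw [← hS₃, ← hW₃] at e3
  change ∫ ω, f (x - W ω) ∂P = f x + ∑ n ∈ Finset.range m,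
    ∫ ω in A n, (∫ u, f (x - S n ω - u) ∂F - f (x - S n ω)) ∂P at e1
  have hx0 : 0 ≤ x := by linarith
  have hM : ∑ n ∈ Finset.range m, ∫ ω in A n, tail F (x - S n ω) ∂P
      ≤ P.real {ω | (x : EReal) < walkMax ξ τ ω} := by
    refine le_trans (le_of_eq ?_) (prob_stoppedWalk_le_prob_walkMax (ξ := ξ) (τ := τ)
      (Y := fun i ω => ζ₃ (ξ i ω)) (y := x / 2) m)
    have h2 : ∫ ω, f (x - W ω) ∂P = P.real {ω | x < W ω} := by
      rw [← integral_indicator_one (measurableSet_lt measurable_const hWm)]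
      congr 1
      funext ω
      simp [hf, indicator_apply]
    have h3 : f x = 0 := indicator_of_notMem (by simpa using hx0) _
    rw [h2, h3, zero_add] at e1
    rw [e1]
    refine Finset.sum_congr rfl fun n _ => setIntegral_congr_fun (hAm n) fun ω hω => ?_
    have h4 : S n ω ≤ x := (hω.2 n le_rfl).1
    have h5 : f (x - S n ω) = 0 := indicator_of_notMem (by simpa using h4) _
    have h6 : (fun u => f (x - S n ω - u)) = (Ioi (x - S n ω)).indicator 1 := by
      funext u
      simp [hf, indicator_apply]
    rw [h5, h6, integral_indicator_one measurableSet_Ioi, sub_zero]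
    rfl
  have hM2 : ∑ n ∈ Finset.range m, ∫ ω in A n, tail F (x - S₂ n ω) ∂P
      ≤ P.real {ω | (x : EReal) < walkMax ξ τ ω} := by
    refine le_trans (Finset.sum_le_sum fun n _ => ?_) hM
    exact integral_mono (integrable_tail_comp (measurable_const.sub (hS₂m n)))
      (integrable_tail_comp (measurable_const.sub (hSm n))) fun ω =>
      tail_antitone (by linarith [hS2 n ω])
  have hDi : ∀ {ζ : ℝ → ℝ} (_ : Measurable ζ) (n : ℕ), Integrable (fun ω =>
      ∫ u, g (x - walk (fun i ω => ζ (ξ i ω)) n ω - ζ u) ∂F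
        - g (x - walk (fun i ω => ζ (ξ i ω)) n ω)) (P.restrict (A n)) := by
    intro ζ hζ n
    have hSm : Measurable (walk (fun i ω => ζ (ξ i ω)) n) :=
      measurable_walk (fun i => hζ.comp (hξ i)) n
    have hφ : Measurable fun p : ℝ × ℝ => g (x - p.1 - ζ p.2) :=
      hgm.comp ((measurable_const.sub measurable_fst).sub (hζ.comp measurable_snd))
    refine Integrable.sub (Integrable.of_bound
      ((hφ.stronglyMeasurable.integral_prod_right').measurable.comp hSm).aestronglyMeasurable
      (tailIntegral F 0) (Eventually.of_forall fun ω => ?_))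
      (Integrable.of_bound (hgm.comp (measurable_const.sub hSm)).aestronglyMeasurable
        (tailIntegral F 0) (Eventually.of_forall fun ω => hgC _))
    refine (norm_integral_le_of_norm_le_const (Eventually.of_forall fun u => hgC _)).trans ?_
    simp
  -- The walk truncated only above lies below the clamped one, hence below x/2 while alive.
  have hs2 : (∫ u, ζ₂ u ∂F) * ∑ n ∈ Finset.range m, ∫ ω in A n, tail F (x - S₂ n ω) ∂P
      ≤ ∑ n ∈ Finset.range m, ∫ ω in A n, (∫ u, g (x - S₂ n ω - ζ₂ u) ∂F - g (x - S₂ n ω)) ∂P := by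
    rw [Finset.mul_sum]
    refine Finset.sum_le_sum fun n _ => ?_
    rw [← integral_const_mul]
    refine setIntegral_mono_on ((integrable_tail_comp (measurable_const.sub (hS₂m n))).const_mul _)
      (hDi hm2 n) (hAm n) fun ω hω => ?_
    have h2 : S₃ n ω ≤ x / 2 := (hω.2 n le_rfl).2
    exact le_drift_tailIntegral hm hm2 hi2 hK (fun u => min_le_right _ _)
      (by linarith [hS23 n ω])
  have hs3 : ∑ n ∈ Finset.range m, ∫ ω in A n, (∫ u, g (x - S₃ n ω - ζ₃ u) ∂F - g (x - S₃ n ω)) ∂P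
      ≤ (∫ u, ζ₃ u ∂F + K * δ) * ∑ n ∈ Finset.range m, ∫ ω in A n, tail F (x - S₃ n ω) ∂P := by
    rw [Finset.mul_sum]
    refine Finset.sum_le_sum fun n _ => ?_
    rw [← integral_const_mul]
    refine setIntegral_mono_on (hDi hm3 n) ((integrable_tail_comp
      (measurable_const.sub (hS₃m n))).const_mul _) (hAm n) fun ω hω => ?_
    have h2 : S₃ n ω ≤ x / 2 := (hω.2 n le_rfl).2
    have h3 := h1 (x - S₃ n ω + K) (by linarith)
    rw [add_sub_cancel_right] at h3
    exact drift_tailIntegral_le hm hm3 hK3 (by linarith) hδ (h1 _ (by linarith)) h3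
  -- Both formulas start from g(x), so this ordering of the end values compares the two
  -- compensators.
  have hle : ∫ ω, g (x - W₂ ω) ∂P ≤ ∫ ω, g (x - W₃ ω) ∂P :=
    integral_mono (Integrable.of_bound (hgm.comp (measurable_const.sub hW₂m)).aestronglyMeasurable
      (tailIntegral F 0) (Eventually.of_forall fun ω => hgC _))
      (Integrable.of_bound (hgm.comp (measurable_const.sub hW₃m)).aestronglyMeasurable
      (tailIntegral F 0) (Eventually.of_forall fun ω => hgC _))
      fun ω => antitone_tailIntegral_max hm 0 (by linarith [h23 ω])
  have hfin := mul_le_mul_of_nonneg_left hM2 (neg_nonneg.2 hneg)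
  linarith

end Comparison

/-! ### The expected tail integral as a series over {τ > n} -/

section ExpectedTailIntegral

variable {Ω : Type*} [mΩ : MeasurableSpace Ω] {P : Measure Ω} [IsProbabilityMeasure P]
  {τ : Ω → ℕ∞} {F : Measure ℝ} [IsProbabilityMeasure F]

lemma measurableSet_lt_time (hτ : Measurable τ) (n : ℕ) : MeasurableSet {ω | (n : ℕ∞) < τ ω} :=
  hτ (MeasurableSet.of_discrete (s := Ioi (n : ℕ∞)))

lemma lintegral_tsum_indicator_lt (hτ : Measurable τ) (f : ℕ → ℝ≥0∞) :
    ∫⁻ ω, ∑' n : ℕ, {ω | (n : ℕ∞) < τ ω}.indicator (fun _ => f n) ω ∂P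
      = ∑' n : ℕ, f n * P {ω | (n : ℕ∞) < τ ω} := by
  rw [lintegral_tsum fun n =>
    (measurable_const.indicator (measurableSet_lt_time hτ n)).aemeasurable]
  exact tsum_congr fun n => lintegral_indicator_const (measurableSet_lt_time hτ n) _

lemma ofReal_le_ofReal_mul_iff {a y : ℝ} (ha : 0 ≤ a) (k : ℕ) :
    ENNReal.ofReal y ≤ ENNReal.ofReal a * (((k : ℕ) : ℕ∞) : ℝ≥0∞) ↔ y ≤ a * k := by
  rw [ENat.toENNReal_coe, ← ENNReal.ofReal_natCast, ← ENNReal.ofReal_mul ha,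
    ENNReal.ofReal_le_ofReal_iff (by positivity)]

/-- For b ≥ a the slices (bn, b(n + 1)] with n < τ cover (0, aτ], and on each slice the tail is at
most its value at the left end. -/
lemma expectedTailIntegral_le_tsum (hτ : Measurable τ) {a b : ℝ} (ha : 0 < a) (hab : a ≤ b)
    (x : ℝ) : expectedTailIntegral F P a τ x ≤
      ∑' n : ℕ, ENNReal.ofReal b * F (Ioi (x + b * n)) * P {ω | (n : ℕ∞) < τ ω} := by
  have hb : 0 < b := ha.trans_le hab
  rw [← lintegral_tsum_indicator_lt hτ]
  refine lintegral_mono fun ω => ?_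
  set s : ℕ → Set ℝ := fun n => {y | (n : ℕ∞) < τ ω ∧ y ∈ Ioc (b * n) (b * (n + 1))} with hs
  have hsub : {y : ℝ | 0 < y ∧ ENNReal.ofReal y ≤ ENNReal.ofReal a * ((τ ω : ℕ∞) : ℝ≥0∞)}
      ⊆ ⋃ n, s n := by
    rintro y ⟨hy, hya⟩
    have hyb : 0 < y / b := by positivity
    have hc : 0 < ⌈y / b⌉₊ := Nat.ceil_pos.2 hyb
    obtain ⟨n, hn⟩ := Nat.exists_eq_succ_of_ne_zero hc.ne'
    have h1 : y ≤ b * (n + 1) := by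
      have h2 := Nat.le_ceil (y / b)
      rw [hn, div_le_iff₀ hb] at h2
      push_cast at h2
      linarith
    have h2 : b * n < y := by
      have h3 : n < ⌈y / b⌉₊ := by omega
      rw [Nat.lt_ceil, lt_div_iff₀ hb] at h3
      linarith
    refine mem_iUnion.2 ⟨n, ?_, h2, h1⟩
    rcases eq_or_ne (τ ω) ⊤ with ht | ht
    · rw [ht]; exact ENat.natCast_lt_top n
    · obtain ⟨k, hk⟩ := ENat.ne_top_iff_exists.1 ht
      rw [← hk, ofReal_le_ofReal_mul_iff ha.le] at hya
      rw [← hk, Nat.cast_lt]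
      by_contra hcon
      have h4 : (k : ℝ) ≤ n := Nat.cast_le.2 (not_lt.1 hcon)
      have h5 : a * k ≤ b * n := mul_le_mul hab h4 (Nat.cast_nonneg _) hb.le
      linarith
  refine (lintegral_mono_set hsub).trans ((lintegral_iUnion_le s _).trans
    (ENNReal.tsum_le_tsum fun n => ?_))
  by_cases hn : (n : ℕ∞) < τ ω
  · rw [indicator_of_mem (show ω ∈ {ω | (n : ℕ∞) < τ ω} from hn)]
    have h1 : s n = Ioc (b * n) (b * (n + 1)) := by
      ext y
      simp [hs, hn]
    rw [h1]
    calc ∫⁻ y in Ioc (b * n) (b * (n + 1)), F (Ioi (x + y))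
        ≤ ∫⁻ _ in Ioc (b * n) (b * (n + 1)), F (Ioi (x + b * n)) :=
          setLIntegral_mono measurable_const fun y hy =>
            measure_mono (Ioi_subset_Ioi (by linarith [hy.1]))
      _ = _ := by
          rw [setLIntegral_const, Real.volume_Ioc, mul_comm]
          congr 2
          ring
  · have h1 : s n = ∅ := by
      ext y
      simp [hs, hn]
    rw [h1]
    simp

/-- For b ≤ a the same slices lie inside (0, aτ] and are disjoint; long-tailedness moves from the
left end of a slice to the right end at the cost of 1 + δ. -/
lemma tsum_le_expectedTailIntegral (hτ : Measurable τ) {a b x δ : ℝ} (hb : 0 < b) (hab : b ≤ a)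
    (hx : ∀ y, x ≤ y → tail F y ≤ (1 + δ) * tail F (y + b)) (hδ : 0 ≤ δ) :
    ∑' n : ℕ, ENNReal.ofReal b * F (Ioi (x + b * n)) * P {ω | (n : ℕ∞) < τ ω}
      ≤ ENNReal.ofReal (1 + δ) * expectedTailIntegral F P a τ x := by
  rw [← lintegral_tsum_indicator_lt hτ, expectedTailIntegral,
    ← lintegral_const_mul' _ _ ENNReal.ofReal_ne_top]
  refine lintegral_mono fun ω => ?_
  set s : ℕ → Set ℝ := fun n => {y | (n : ℕ∞) < τ ω ∧ y ∈ Ioc (b * n) (b * (n + 1))} with hs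
  have hsm : ∀ n, MeasurableSet (s n) := fun n => by
    by_cases hn : (n : ℕ∞) < τ ω
    · have h1 : s n = Ioc (b * n) (b * (n + 1)) := by
        ext y
        simp [hs, hn]
      rw [h1]
      exact measurableSet_Ioc
    · have h1 : s n = ∅ := by
        ext y
        simp [hs, hn]
      rw [h1]
      exact MeasurableSet.empty
  have hdisj : Pairwise (Function.onFun Disjoint s) := by
    have key : ∀ i j : ℕ, i < j → Disjoint (s i) (s j) := fun i j hij => by
      refine disjoint_left.2 fun y hy1 hy2 => ?_
      have h1 : ((i : ℝ) + 1) ≤ j := by exact_mod_cast hij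
      have h2 := mul_le_mul_of_nonneg_left h1 hb.le
      linarith [hy1.2.2, hy2.2.1]
    intro i j hij
    rcases lt_or_gt_of_ne hij with h | h
    · exact key i j h
    · exact (key j i h).symm
  have hsub : ⋃ n, s n ⊆ {y : ℝ | 0 < y ∧
      ENNReal.ofReal y ≤ ENNReal.ofReal a * ((τ ω : ℕ∞) : ℝ≥0∞)} := by
    intro y hy
    obtain ⟨n, hn, hy1, hy2⟩ := mem_iUnion.1 hy
    have hbn : 0 ≤ b * n := by positivity
    refine ⟨by linarith, ?_⟩
    have h1 : ((n + 1 : ℕ) : ℕ∞) ≤ τ ω := by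
      rw [Nat.cast_succ]
      exact Order.add_one_le_of_lt hn
    calc ENNReal.ofReal y ≤ ENNReal.ofReal a * (((n + 1 : ℕ) : ℕ∞) : ℝ≥0∞) := by
          rw [ofReal_le_ofReal_mul_iff (hb.le.trans hab)]
          push_cast
          exact hy2.trans (mul_le_mul_of_nonneg_right hab (by positivity))
      _ ≤ _ := by gcongr
  refine le_trans ?_ (mul_le_mul_right (lintegral_mono_set hsub) _)
  rw [lintegral_iUnion hsm hdisj, ← ENNReal.tsum_mul_left]
  refine ENNReal.tsum_le_tsum fun n => ?_
  by_cases hn : (n : ℕ∞) < τ ω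
  · rw [indicator_of_mem (show ω ∈ {ω | (n : ℕ∞) < τ ω} from hn)]
    have h1 : s n = Ioc (b * n) (b * (n + 1)) := by
      ext y
      simp [hs, hn]
    rw [h1]
    have hbn : 0 ≤ b * n := by positivity
    have h2 : F (Ioi (x + b * n)) ≤ ENNReal.ofReal (1 + δ) * F (Ioi (x + b * n + b)) := by
      rw [← ofReal_tail, ← ofReal_tail, ← ENNReal.ofReal_mul (by linarith)]
      exact ENNReal.ofReal_le_ofReal (hx _ (by linarith))
    calc ENNReal.ofReal b * F (Ioi (x + b * n))
        ≤ ENNReal.ofReal b * (ENNReal.ofReal (1 + δ) * F (Ioi (x + b * n + b))) := by gcongr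
      _ = ENNReal.ofReal (1 + δ) *
          ∫⁻ _ in Ioc (b * n) (b * (n + 1)), F (Ioi (x + b * n + b)) := by
          rw [setLIntegral_const, Real.volume_Ioc,
            show b * ((n : ℝ) + 1) - b * n = b by ring]
          ring
      _ ≤ _ := by
          refine mul_le_mul_right (setLIntegral_mono_ae' measurableSet_Ioc
            (Eventually.of_forall fun y hy => measure_mono (Ioi_subset_Ioi ?_))) _
          linarith [hy.2]
  · rw [indicator_of_notMem (show ω ∉ {ω | (n : ℕ∞) < τ ω} from hn)]
    exact zero_le

lemma expectedTailIntegral_ne_top (hm : Integrable (fun x : ℝ => x) F) (a x : ℝ) :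
    expectedTailIntegral F P a τ x ≠ ⊤ := by
  have h1 : ∫⁻ y in Ioi (0 : ℝ), F (Ioi (x + y)) < ⊤ := by
    have h2 : IntegrableOn (fun y => tail F (x + y)) (Ioi 0) := by
      have h3 := (measurePreserving_add_left volume x).integrableOn_comp_preimage
        (measurableEmbedding_addLeft x) (f := tail F) (s := Ioi x)
      rw [show (fun y => x + y) ⁻¹' Ioi x = Ioi 0 by ext y; simp] at h3
      exact h3.2 (integrableOn_Ioi_tail hm x)
    have h3 := (hasFiniteIntegral_iff_ofReal
      (Eventually.of_forall fun y => tail_nonneg (F := F) (x + y))).1 h2.2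
    simpa only [ofReal_tail] using h3
  refine ne_top_of_le_ne_top h1.ne ?_
  calc expectedTailIntegral F P a τ x
      ≤ ∫⁻ _, (∫⁻ y in Ioi (0 : ℝ), F (Ioi (x + y))) ∂P :=
        lintegral_mono fun ω => lintegral_mono_set fun y hy => hy.1
    _ = _ := by simp

lemma ofReal_prob_mul_tail (b x : ℝ) (hb : 0 ≤ b) (n : ℕ) :
    ENNReal.ofReal b * F (Ioi (x + b * n)) * P {ω | (n : ℕ∞) < τ ω}
      = ENNReal.ofReal (b * (P.real {ω | (n : ℕ∞) < τ ω} * tail F (x + b * n))) := by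
  rw [ENNReal.ofReal_mul hb, ENNReal.ofReal_mul measureReal_nonneg, ofReal_tail,
    ofReal_measureReal (measure_ne_top _ _)]
  ring

lemma sum_prob_mul_tail_le (hm : Integrable (fun x : ℝ => x) F) (hτ : Measurable τ) {a b x δ : ℝ}
    (hb : 0 < b) (hab : b ≤ a) (hx : ∀ y, x ≤ y → tail F y ≤ (1 + δ) * tail F (y + b))
    (hδ : 0 ≤ δ) (m : ℕ) :
    b * ∑ n ∈ Finset.range m, P.real {ω | (n : ℕ∞) < τ ω} * tail F (x + b * n)
      ≤ (1 + δ) * (expectedTailIntegral F P a τ x).toReal := by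
  have h1 := tsum_le_expectedTailIntegral (P := P) hτ hb hab hx hδ
  simp only [ofReal_prob_mul_tail b x hb.le] at h1
  have h2 := (ENNReal.sum_le_tsum (Finset.range m)).trans h1
  have hnn : ∀ n : ℕ, 0 ≤ b * (P.real {ω | (n : ℕ∞) < τ ω} * tail F (x + b * n)) := fun n =>
    mul_nonneg hb.le (mul_nonneg measureReal_nonneg (tail_nonneg _))
  rw [← ENNReal.ofReal_sum_of_nonneg fun n _ => hnn n,
    ← ENNReal.ofReal_toReal (expectedTailIntegral_ne_top hm a x),
    ← ENNReal.ofReal_mul (by linarith), ENNReal.ofReal_le_ofReal_iff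
      (mul_nonneg (by linarith) ENNReal.toReal_nonneg)] at h2
  rwa [Finset.mul_sum]

lemma expectedTailIntegral_le_of_sum_le (hτ : Measurable τ) {a b x B : ℝ} (ha : 0 < a)
    (hab : a ≤ b) (hB : ∀ m, ∑ n ∈ Finset.range m,
      P.real {ω | (n : ℕ∞) < τ ω} * tail F (x + b * n) ≤ B) :
    (expectedTailIntegral F P a τ x).toReal ≤ b * B := by
  have hb : 0 < b := ha.trans_le hab
  have hB0 : 0 ≤ B := by simpa using hB 0
  refine ENNReal.toReal_le_of_le_ofReal (by positivity)
    ((expectedTailIntegral_le_tsum hτ ha hab x).trans ?_)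
  refine ENNReal.tsum_le_of_sum_range_le fun m => ?_
  simp only [ofReal_prob_mul_tail b x hb.le]
  rw [← ENNReal.ofReal_sum_of_nonneg fun n _ =>
    mul_nonneg hb.le (mul_nonneg measureReal_nonneg (tail_nonneg _)), ← Finset.mul_sum]
  exact ENNReal.ofReal_le_ofReal (mul_le_mul_of_nonneg_left (hB m) hb.le)

lemma sum_tail_le (hm : Integrable (fun x : ℝ => x) F) (x b : ℝ) (m : ℕ) :
    b * ∑ n ∈ Finset.range m, tail F (x + b * n) ≤ tailIntegral F (x - b) := by
  have h : ∀ m : ℕ, b * ∑ n ∈ Finset.range m, tail F (x + b * n)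
      ≤ tailIntegral F (x - b) - tailIntegral F (x + b * m - b) := by
    intro m
    induction m with
    | zero => simp
    | succ m ih =>
      rw [Finset.sum_range_succ, mul_add]
      have h1 := mul_tail_le_tailIntegral_sub hm (x + b * m) b
      rw [show x + b * ((m + 1 : ℕ) : ℝ) - b = x + b * m by push_cast; ring]
      linarith
  exact (h m).trans (sub_le_self _ (tailIntegral_nonneg _))

end ExpectedTailIntegral

/-! ### Truncated means -/

section Truncation

variable {F : Measure ℝ} [IsProbabilityMeasure F]

lemma tendsto_integral_max_neg (hm : Integrable (fun x : ℝ => x) F) :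
    Tendsto (fun K : ℕ => ∫ u, max u (-(K : ℝ)) ∂F) atTop (𝓝 (∫ u, u ∂F)) := by
  refine tendsto_integral_of_dominated_convergence (fun u => |u|)
    (fun n => by fun_prop) hm.abs (fun n => Eventually.of_forall fun u => ?_)
    (Eventually.of_forall fun u => ?_)
  · rw [Real.norm_eq_abs, abs_le]
    have := Nat.cast_nonneg (α := ℝ) n
    exact ⟨(neg_abs_le u).trans (le_max_left _ _),
      max_le (le_abs_self u) (by linarith [abs_nonneg u])⟩
  · refine tendsto_const_nhds.congr' ?_
    filter_upwards [eventually_ge_atTop ⌈-u⌉₊] with n hn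
    have := Nat.ceil_le.1 hn
    exact (max_eq_left (by linarith)).symm

lemma tendsto_integral_min (hm : Integrable (fun x : ℝ => x) F) :
    Tendsto (fun K : ℕ => ∫ u, min u (K : ℝ) ∂F) atTop (𝓝 (∫ u, u ∂F)) := by
  refine tendsto_integral_of_dominated_convergence (fun u => |u|)
    (fun n => by fun_prop) hm.abs (fun n => Eventually.of_forall fun u => ?_)
    (Eventually.of_forall fun u => ?_)
  · rw [Real.norm_eq_abs, abs_le]
    have := Nat.cast_nonneg (α := ℝ) n
    exact ⟨le_min (neg_abs_le u) (by linarith [abs_nonneg u]),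
      (min_le_left _ _).trans (le_abs_self u)⟩
  · refine tendsto_const_nhds.congr' ?_
    filter_upwards [eventually_ge_atTop ⌈u⌉₊] with n hn
    exact (min_eq_left (Nat.ceil_le.1 hn)).symm

lemma integrable_max_neg (hm : Integrable (fun x : ℝ => x) F) (K : ℝ) :
    Integrable (fun u => max u (-K)) F := by
  exact hm.sup (integrable_const (-K))

lemma integrable_min (hm : Integrable (fun x : ℝ => x) F) (K : ℝ) :
    Integrable (fun u => min u K) F := by
  exact hm.inf (integrable_const K)

lemma integrable_clamp (hm : Integrable (fun x : ℝ => x) F) (K : ℝ) :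
    Integrable (fun u => max (min u K) (-K)) F := by
  exact (integrable_min hm K).sup (integrable_const (-K))

lemma exists_truncation (hm : Integrable (fun x : ℝ => x) F) {a δ : ℝ} (ha : 0 < a)
    (hmean : ∫ x, x ∂F = -a) (hδ : 0 < δ) : ∃ K : ℝ, 0 < K ∧
      a * (1 - δ) < -(∫ u, max u (-K) ∂F) ∧
      -(∫ u, max u (-K) ∂F) ≤ -(∫ u, max (min u K) (-K) ∂F) ∧
      -(∫ u, max (min u K) (-K) ∂F) ≤ -(∫ u, min u K ∂F) ∧
      -(∫ u, min u K ∂F) < a * (1 + δ) := by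
  have h1 := (tendsto_integral_max_neg hm).eventually_lt_const
    (show ∫ u, u ∂F < -(a * (1 - δ)) by rw [hmean]; nlinarith)
  have h2 := (tendsto_integral_min hm).eventually_const_lt
    (show -(a * (1 + δ)) < ∫ u, u ∂F by rw [hmean]; nlinarith)
  obtain ⟨K, ⟨h3, h4⟩, h5⟩ := ((h1.and h2).and (eventually_gt_atTop 0)).exists
  refine ⟨K, Nat.cast_pos.2 h5, by linarith, neg_le_neg ?_, neg_le_neg ?_, by linarith⟩
  · exact integral_mono (integrable_clamp hm K) (integrable_max_neg hm K) fun u =>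
      max_le_max_right _ (min_le_left _ _)
  · exact integral_mono (integrable_min hm K) (integrable_clamp hm K) fun u => le_max_left _ _

/-- By max(u, -K) = u⁺ - min(u⁻, K). This identifies the constant in the Lyapunov condition with
minus the mean of the jump truncated below. -/
lemma integral_min_neg_part (hm : Integrable (fun x : ℝ => x) F) {K : ℝ} (hK : 0 ≤ K) :
    (∫ u, min (max (-u) 0) K ∂F) - tailIntegral F 0 = -∫ u, max u (-K) ∂F := by
  have h1 : ∀ u : ℝ, max u (-K) = max u 0 - min (max (-u) 0) K := fun u => by
    rcases le_total 0 u with h | h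
    · rw [max_eq_left (by linarith), max_eq_left h, max_eq_right (by linarith), min_eq_left hK,
        sub_zero]
    · rw [max_eq_right h, max_eq_left (by linarith : (0 : ℝ) ≤ -u), zero_sub, ← max_neg_neg,
        neg_neg]
  have h2 : Integrable (fun u => min (max (-u) 0) K) F :=
    Integrable.of_bound (by fun_prop) K (Eventually.of_forall fun u => by
      rw [Real.norm_eq_abs, abs_of_nonneg (le_min (le_max_right _ _) hK)]
      exact min_le_right _ _)
  simp only [h1]
  rw [integral_sub hm.pos_part h2, integral_pos_part hm, tailIntegral]
  ring

end Truncation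

/-! ### Uniform upper and lower bounds -/

section UniformBounds

variable {F : Measure ℝ} [IsProbabilityMeasure F]

lemma abs_clamp_le {K : ℝ} (hK : 0 ≤ K) (u : ℝ) : |max (min u K) (-K)| ≤ K :=
  abs_le.2 ⟨le_max_right _ _, max_le (min_le_right _ _) (by linarith)⟩

lemma exists_mul_pow_div_le {ρ C δ : ℝ} (h0 : 0 ≤ ρ) (h1 : ρ < 1) (hδ : 0 < δ) :
    ∃ N : ℕ, C * ρ ^ N / (1 - ρ) ≤ δ := by
  have h := ((tendsto_pow_atTop_nhds_zero_of_lt_one h0 h1).const_mul C).div_const (1 - ρ)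
  rw [mul_zero, zero_div] at h
  exact (h.eventually_le_const hδ).exists

/-- The truncated walk exceeds half of a high level with negligible probability. -/
lemma StrongSubexponential.prob_exists_clamp_lt_le (hF : StrongSubexponential F) {K δ : ℝ}
    (hK : 0 ≤ K) (hneg : ∫ u, max (min u K) (-K) ∂F < 0) (hδ : 0 < δ) :
    ∀ᶠ x : ℝ in atTop, ∀ (Ω : Type*) [MeasurableSpace Ω] (P : Measure Ω) [IsProbabilityMeasure P]
      (ξ : ℕ → Ω → ℝ), (∀ i, Measurable (ξ i)) → iIndepFun ξ P → (∀ i, P.map (ξ i) = F) →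
      P.real {ω | ∃ k, x / 2 < walk (fun i ω => max (min (ξ i ω) K) (-K)) k ω}
        ≤ δ * tail F x := by
  have hm : Measurable fun u : ℝ => max (min u K) (-K) := by fun_prop
  obtain ⟨θ, hθ, hρ⟩ := exists_integral_exp_lt_one hm (abs_clamp_le hK) hneg
  set ρ := ∫ u, Real.exp (θ * max (min u K) (-K)) ∂F with hρd
  have h1 : 0 < 1 - ρ := by linarith
  filter_upwards [hF.exp_le_tail (half_pos hθ) (mul_pos hδ h1)] with x hx Ω _ P _ ξ hξ hind hmap
  refine (prob_exists_lt_walk_le hξ hind hmap hm (abs_clamp_le hK) hθ hρ (x / 2)).trans ?_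
  rw [← hρd, div_le_iff₀ h1, show θ * (x / 2) = θ / 2 * x by ring]
  linarith

lemma StrongSubexponential.exists_forall_tail_le (hF : StrongSubexponential F) (K : ℝ) {δ : ℝ}
    (hδ : 0 < δ) : ∀ᶠ x in atTop, ∀ y, x ≤ y → tail F y ≤ (1 + δ) * tail F (y + K) := by
  obtain ⟨z, hz⟩ := eventually_atTop.1 (hF.long_tailed K hδ)
  filter_upwards [eventually_ge_atTop (z - K)] with x hx y hy
  have := hz (y + K) (by linarith)
  rwa [add_sub_cancel_right] at this

/-- The term n = 0 of the series alone, with P{τ > 0} = 1. It lets errors of size δF̄(x) be absorbed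
in the main term. -/
lemma tail_le_expectedTailIntegral {Ω : Type*} [MeasurableSpace Ω] {P : Measure Ω}
    [IsProbabilityMeasure P] {τ : Ω → ℕ∞} (hm : Integrable (fun x : ℝ => x) F) (hτ : Measurable τ)
    (hτ1 : ∀ᵐ ω ∂P, 1 ≤ τ ω) {a x δ : ℝ} (ha : 0 < a)
    (hx : ∀ y, x ≤ y → tail F y ≤ (1 + δ) * tail F (y + a)) (hδ : 0 ≤ δ) :
    tail F x ≤ (1 + δ) * (1 / a * (expectedTailIntegral F P a τ x).toReal) := by
  have h1 := sum_prob_mul_tail_le (P := P) hm hτ ha le_rfl hx hδ 1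
  have h2 : P.real {ω | ((0 : ℕ) : ℕ∞) < τ ω} = 1 := by
    rw [measureReal_def, prob_compl_eq_zero_iff (measurableSet_lt_time hτ 0) |>.1]
    · rfl
    · rw [← mem_ae_iff]
      filter_upwards [hτ1] with ω hω
      exact lt_of_lt_of_le (by simp) hω
  rw [Finset.sum_range_one, h2, Nat.cast_zero, mul_zero, add_zero, one_mul] at h1
  have h3 : tail F x ≤ (1 + δ) * (expectedTailIntegral F P a τ x).toReal / a := by
    rw [le_div_iff₀ ha]
    linarith
  exact h3.trans_eq (by ring)

/-- The upper bound, uniform over all random times that do not depend on the future. -/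
lemma StrongSubexponential.prob_walkMax_le (hF : StrongSubexponential F) {a δ : ℝ} (ha : 0 < a)
    (hmean : ∫ x, x ∂F = -a) (hδ : 0 < δ) (hδ4 : δ < 1 / 4) :
    ∀ᶠ x : ℝ in atTop, ∀ (Ω : Type*) [MeasurableSpace Ω] (P : Measure Ω) [IsProbabilityMeasure P]
      (ξ : ℕ → Ω → ℝ), (∀ i, Measurable (ξ i)) → iIndepFun ξ P → (∀ i, P.map (ξ i) = F) →
      ∀ τ : Ω → ℕ∞, Measurable τ → (∀ᵐ ω ∂P, 1 ≤ τ ω) → NotDependOnFuture P ξ τ →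
        P.real {ω | (x : EReal) < walkMax ξ τ ω} ≤
          ((1 + δ) ^ 2 / (1 - δ) ^ 2 * ((1 + δ) ^ 2 / (1 - 2 * δ) + δ * (1 + δ)) + δ * (1 + δ))
            * (1 / a * (expectedTailIntegral F P a τ x).toReal) := by
  have hm := hF.finite_mean
  obtain ⟨K, hK, hK1, hK2, hK3, hK4⟩ := exists_truncation hm ha hmean hδ
  set ζ : ℝ → ℝ := fun u => max (min u K) (-K) with hζ
  have hζm : Measurable ζ := by fun_prop
  have hζK : ∀ u, |ζ u| ≤ K := abs_clamp_le hK.le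
  have hζi : Integrable ζ F := integrable_clamp hm K
  set a₁ := -(∫ u, max u (-K) ∂F) with ha₁
  set a₃ := -(∫ u, ζ u ∂F) with ha₃
  have ha₁0 : 0 < a₁ := lt_trans (mul_pos ha (by linarith)) hK1
  -- Below the clamped drift a₃ > a(1 - δ), so the clamped walk shifted by bn still drifts to -∞.
  set b := a * (1 - 2 * δ) with hb
  have hb0 : 0 < b := mul_pos ha (by linarith)
  have hba : b ≤ a := by rw [hb]; nlinarith
  have hba₁ : b < a₁ := lt_trans (by rw [hb]; nlinarith) hK1
  obtain ⟨θ, hθ, hρ⟩ := exists_integral_exp_lt_one (F := F) (X := fun u => ζ u + b)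
    (hζm.add_const b) (C := K + b)
    (fun u => (abs_add_le _ _).trans (add_le_add (hζK u) (abs_of_pos hb0).le)) (by
      rw [integral_add hζi (integrable_const b)]
      simp only [integral_const, probReal_univ, one_smul]
      linarith)
  set ρ := ∫ u, Real.exp (θ * (ζ u + b)) ∂F with hρd
  have hρ0 : 0 ≤ ρ := integral_nonneg fun u => (Real.exp_pos _).le
  obtain ⟨N, hN⟩ := exists_mul_pow_div_le (C := Real.exp θ) hρ0 hρ hδ
  -- The Lyapunov condition is c a₁ > 1; the factor 1 + δ makes it strict.
  set c := (1 + δ) / a₁ with hc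
  have hc0 : 0 < c := div_pos (by linarith) ha₁0
  have hca : c * a₁ = 1 + δ := div_mul_cancel₀ _ ha₁0.ne'
  obtain ⟨h, hhm, ⟨C, hhC⟩, -, hhneg, hhanti, hhdrift, hhc⟩ :=
    hF.exists_lyapunov hK.le hc0 (by
      rw [integral_min_neg_part hm hK.le, ← ha₁, hca]
      linarith)
  have hψ := (tendsto_tailIntegral hm).eventually_le_const (show 0 < δ / c by positivity)
  obtain ⟨y₀, hy₀⟩ := eventually_atTop.1 (hhc.and hψ)
  set y₂ := max y₀ 0 with hy₂
  have hy₂c : c * tailIntegral F y₂ ≤ δ := by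
    have := (hy₀ y₂ (le_max_left _ _)).2
    rwa [le_div_iff₀ hc0, mul_comm] at this
  obtain ⟨u, hu⟩ := hF.exists_tail_sub_le_exp hθ
  have hlong : ∀ᶠ x in atTop, tail F (x - N * K) ≤ (1 + δ) * tail F (x + b * N) := by
    have h1 := (tendsto_atTop_add_const_right atTop (b * N) tendsto_id).eventually
      (hF.long_tailed (b * N + N * K) hδ)
    filter_upwards [h1] with x hx
    simpa only [id, add_sub_add_left_eq_sub, ← sub_sub, add_sub_cancel_right] using hx
  filter_upwards [hlong, hF.exists_forall_tail_le a hδ, hF.exists_forall_tail_le b hδ,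
    hF.prob_exists_clamp_lt_le hK.le (show ∫ u, ζ u ∂F < 0 by linarith) hδ,
    eventually_ge_atTop (2 * (y₂ + K)), eventually_ge_atTop (2 * u)]
    with x hx1 hx2 hx3 hx4 hx5 hx6 Ω _ P _ ξ hξ hind hmap τ hτ hτ1 hfut
  have hT := tail_nonneg (F := F) x
  have hTR := tail_le_expectedTailIntegral (P := P) hm hτ hτ1 ha hx2 hδ.le
  have hP₃ := hx4 Ω P ξ hξ hind hmap
  set E := (expectedTailIntegral F P a τ x).toReal with hE
  have hE0 : 0 ≤ E := ENNReal.toReal_nonneg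
  set R := 1 / a * E with hR
  have hR0 : 0 ≤ R := by positivity
  set A := aliveSet τ (fun i ω => max (ξ i ω) (-K)) x (fun i ω => ζ (ξ i ω)) (x / 2) with hA
  have hAm : ∀ n, MeasurableSet (A n) := fun n => past_le hξ hτ n _
    (measurableSet_past_aliveSet ξ τ (show Measurable fun u : ℝ => max u (-K) by fun_prop)
      hζm x (x / 2) n)
  have hB : ∀ m, P.real {ω | x < stoppedWalk A (fun i ω => max (ξ i ω) (-K)) m ω}
      ≤ (1 + δ) ^ 2 / (1 - δ) ^ 2 * ((1 + δ) ^ 2 / (1 - 2 * δ) + δ * (1 + δ)) * R := by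
    intro m
    have e1 := prob_stoppedWalk_le hm hξ hmap hτ hfut hK.le hhm hhC hhneg hhanti hhdrift hc0.le
      (le_max_right y₀ 0) (fun y hy => (hy₀ y ((le_max_left _ _).trans hy)).1)
      (show y₂ + K ≤ x / 2 by linarith) m
    have e2 := sum_setIntegral_tail_le hξ hind hmap hζm hK.le hζK hb0.le hδ.le hθ hρ N m hx1
      (y := x / 2) (fun s hs hsx => hu x s hs (by linarith)) hAm
      (fun n ω hω => (hω.2 n le_rfl).2) (by linarith [le_max_right y₀ 0])
    have e3 := sum_prob_mul_tail_le (P := P) hm hτ hb0 hba hx3 hδ.le m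
    rw [← hE] at e3
    have e4 : ∑ n ∈ Finset.range m, P.real (A n) * tail F (x + b * n)
        ≤ ∑ n ∈ Finset.range m, P.real {ω | (n : ℕ∞) < τ ω} * tail F (x + b * n) :=
      Finset.sum_le_sum fun n _ => mul_le_mul_of_nonneg_right
        (measureReal_mono fun ω hω => hω.1) (tail_nonneg _)
    set B := ∑ n ∈ Finset.range m, ∫ ω in A n, tail F (x - walk (fun i ω => ζ (ξ i ω)) n ω) ∂P
      with hB
    have hB0 : 0 ≤ B := Finset.sum_nonneg fun n _ => integral_nonneg fun ω => tail_nonneg _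
    have e5 : ∑ n ∈ Finset.range m, P.real {ω | (n : ℕ∞) < τ ω} * tail F (x + b * n)
        ≤ (1 + δ) / (1 - 2 * δ) * R := by
      have h1 : (1 + δ) / (1 - 2 * δ) * R = (1 + δ) * E / b := by
        rw [hR, hb]
        have : (1 - 2 * δ) ≠ 0 := by linarith
        field_simp
      rw [h1, le_div_iff₀ hb0, mul_comm]
      exact e3
    have e6 : B ≤ ((1 + δ) ^ 2 / (1 - 2 * δ) + δ * (1 + δ)) * R := by
      have h1 := mul_le_mul_of_nonneg_left (e4.trans e5) (show 0 ≤ 1 + δ by linarith)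
      have h2 := mul_le_mul_of_nonneg_right hN hT
      have h3 := mul_le_mul_of_nonneg_left hTR hδ.le
      calc B ≤ _ := e2
        _ ≤ (1 + δ) * ((1 + δ) / (1 - 2 * δ) * R) + δ * ((1 + δ) * R) := by linarith
        _ = _ := by ring
    have e7 : c * a₃ ≤ (1 + δ) ^ 2 / (1 - δ) := by
      rw [hc, div_mul_eq_mul_div, div_le_div_iff₀ ha₁0 (by linarith)]
      have h1 : a₃ * (1 - δ) ≤ a * (1 + δ) * (1 - δ) :=
        mul_le_mul_of_nonneg_right (by linarith) (by linarith)
      have h2 : a * (1 - δ) * (1 + δ) ≤ a₁ * (1 + δ) :=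
        mul_le_mul_of_nonneg_right hK1.le (by linarith)
      have h3 := mul_le_mul_of_nonneg_left (h1.trans ((by ring :
        a * (1 + δ) * (1 - δ) = a * (1 - δ) * (1 + δ)).le.trans h2)) (show 0 ≤ 1 + δ by linarith)
      linarith
    set p := P.real {ω | x < stoppedWalk A (fun i ω => max (ξ i ω) (-K)) m ω} with hp
    have hp0 : 0 ≤ p := measureReal_nonneg
    have e8 : (1 - δ) * p ≤ (1 + δ) ^ 2 / (1 - δ)
        * (((1 + δ) ^ 2 / (1 - 2 * δ) + δ * (1 + δ)) * R) := by
      calc (1 - δ) * p ≤ (1 - c * tailIntegral F y₂) * p :=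
            mul_le_mul_of_nonneg_right (by linarith) hp0
        _ ≤ c * a₃ * B := e1
        _ ≤ (1 + δ) ^ 2 / (1 - δ) * B := mul_le_mul_of_nonneg_right e7 hB0
        _ ≤ _ := mul_le_mul_of_nonneg_left e6 (div_nonneg (by positivity) (by linarith))
    have h1 : 0 < 1 - δ := by linarith
    calc p ≤ (1 + δ) ^ 2 / (1 - δ) * (((1 + δ) ^ 2 / (1 - 2 * δ) + δ * (1 + δ)) * R) / (1 - δ) := by
          rw [le_div_iff₀ h1, mul_comm]
          exact e8
      _ = _ := by
          generalize (1 + δ) ^ 2 / (1 - 2 * δ) + δ * (1 + δ) = q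
          field_simp
  have hfin := prob_lt_walkMax_le (P := P) (ξ := ξ) (τ := τ) (Y := fun i ω => ζ (ξ i ω))
    (X := fun i ω => max (ξ i ω) (-K)) (y := x / 2) (fun i ω => le_max_left _ _) hB
  have h3 := mul_le_mul_of_nonneg_left hTR hδ.le
  rw [add_mul]
  linarith

/-- The lower bound, uniform over all random times that do not depend on the future. -/
lemma StrongSubexponential.le_prob_walkMax (hF : StrongSubexponential F) {a δ : ℝ} (ha : 0 < a)
    (hmean : ∫ x, x ∂F = -a) (hδ : 0 < δ) (hδ4 : δ < 1 / 4) :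
    ∀ᶠ x : ℝ in atTop, ∀ (Ω : Type*) [MeasurableSpace Ω] (P : Measure Ω) [IsProbabilityMeasure P]
      (ξ : ℕ → Ω → ℝ), (∀ i, Measurable (ξ i)) → iIndepFun ξ P → (∀ i, P.map (ξ i) = F) →
      ∀ τ : Ω → ℕ∞, Measurable τ → (∀ᵐ ω ∂P, 1 ≤ τ ω) → NotDependOnFuture P ξ τ →
        (1 - (1 + 2 * δ) * (1 + δ) * (δ + 2 * δ ^ 2))
            * (1 / a * (expectedTailIntegral F P a τ x).toReal)
          ≤ (1 + 2 * δ) * ((1 + δ) ^ 2 / (1 - 2 * δ) + δ)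
            * P.real {ω | (x : EReal) < walkMax ξ τ ω} := by
  have hm := hF.finite_mean
  obtain ⟨K, hK, hK1, hK2, hK3, hK4⟩ := exists_truncation hm ha hmean hδ
  set ζ : ℝ → ℝ := fun u => max (min u K) (-K) with hζ
  have hζm : Measurable ζ := by fun_prop
  have hζK : ∀ u, |ζ u| ≤ K := abs_clamp_le hK.le
  have hζi : Integrable ζ F := integrable_clamp hm K
  set a₂ := -(∫ u, min u K ∂F) with ha₂
  set a₃ := -(∫ u, ζ u ∂F) with ha₃
  have ha₃0 : a * (1 - δ) < a₃ := hK1.trans_le hK2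
  have haδ : 0 < a * δ := mul_pos ha hδ
  have haδ1 : 0 < a * (1 - δ) := mul_pos ha (by linarith)
  -- Above the clamped drift a₃ < a(1 + δ), so here it is -(S_n + bn) that drifts to -∞.
  set b := a * (1 + 2 * δ) with hb
  have hb0 : 0 < b := mul_pos ha (by linarith)
  have hba : a ≤ b := by rw [hb]; nlinarith
  obtain ⟨θ, hθ, hρ⟩ := exists_integral_exp_lt_one (F := F) (X := fun u => -(ζ u + b))
    (hζm.add_const b).neg (C := K + b)
    (fun u => by
      rw [abs_neg]
      exact (abs_add_le _ _).trans (add_le_add (hζK u) (abs_of_pos hb0).le)) (by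
      rw [integral_neg, integral_add hζi (integrable_const b)]
      simp only [integral_const, probReal_univ, one_smul]
      linarith)
  set ρ := ∫ u, Real.exp (θ * -(ζ u + b)) ∂F with hρd
  have hρ0 : 0 ≤ ρ := integral_nonneg fun u => (Real.exp_pos _).le
  obtain ⟨N, hN⟩ := exists_mul_pow_div_le (C := 1) hρ0 hρ hδ
  rw [one_mul] at hN
  -- With this tolerance the drift error K · (δa/K) is δa, comparable with the drift itself.
  have hδK : 0 < δ * a / K := by positivity
  obtain ⟨z, hz⟩ := eventually_atTop.1 (hF.long_tailed K hδK)
  have hψ : ∀ᶠ x in atTop, tailIntegral F (x - b) ≤ δ * b :=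
    (tendsto_atTop_add_const_right atTop (-b) tendsto_id).eventually
      ((tendsto_tailIntegral hm).eventually_le_const (show 0 < δ * b by positivity))
  filter_upwards [hF.exists_forall_tail_le a hδ, hF.exists_forall_tail_le (N * K) hδ, hψ,
    hF.prob_exists_clamp_lt_le hK.le (show ∫ u, ζ u ∂F < 0 by linarith) hδ,
    eventually_ge_atTop (2 * K), eventually_ge_atTop (2 * z)]
    with x hx1 hx2 hx3 hx4 hx5 hx6 Ω _ P _ ξ hξ hind hmap τ hτ hτ1 hfut
  have hT := tail_nonneg (F := F) x
  have hTR := tail_le_expectedTailIntegral (P := P) hm hτ hτ1 ha hx1 hδ.le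
  have hP₃ := hx4 Ω P ξ hξ hind hmap
  set E := (expectedTailIntegral F P a τ x).toReal with hE
  have hE0 : 0 ≤ E := ENNReal.toReal_nonneg
  set R := 1 / a * E with hR
  have hR0 : 0 ≤ R := by positivity
  set M := P.real {ω | (x : EReal) < walkMax ξ τ ω} with hM
  have hM0 : 0 ≤ M := measureReal_nonneg
  set P₃ := P.real {ω | ∃ k, x / 2 < walk (fun i ω => max (min (ξ i ω) K) (-K)) k ω} with hP₃d
  set A := aliveSet τ ξ x (fun i ω => ζ (ξ i ω)) (x / 2) with hA
  have hAm : ∀ n, MeasurableSet (A n) := fun n => past_le hξ hτ n _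
    (measurableSet_past_aliveSet ξ τ measurable_id hζm x (x / 2) n)
  have hB : ∀ m, ∑ n ∈ Finset.range m, P.real {ω | (n : ℕ∞) < τ ω} * tail F (x + b * n)
      ≤ (1 + δ) * ((1 + δ) / (1 - 2 * δ) * M + δ * tail F x) + δ * (M + δ * tail F x) := by
    intro m
    have e1 := mul_sum_setIntegral_tail_le_prob hm hξ hmap hτ hfut hK.le hδK.le
      (show K ≤ x / 2 by linarith) (fun y hy => hz y (by linarith)) (by linarith) m
    have e2 := le_sum_setIntegral_tail hξ hind hmap hζm hK.le hζK hb0.le hδ.le hρ hθ N m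
      (hx2 x le_rfl) hAm
    set B := ∑ n ∈ Finset.range m, ∫ ω in A n, tail F (x - walk (fun i ω => ζ (ξ i ω)) n ω) ∂P
      with hB
    have hB0 : 0 ≤ B := Finset.sum_nonneg fun n _ => integral_nonneg fun ω => tail_nonneg _
    have e3 : B ≤ (1 + δ) / (1 - 2 * δ) * M := by
      have h1 : a * (1 - 2 * δ) * B ≤ a * (1 + δ) * M := by
        calc a * (1 - 2 * δ) * B ≤ (a₃ - K * (δ * a / K)) * B := by
              refine mul_le_mul_of_nonneg_right ?_ hB0
              rw [mul_div_cancel₀ _ hK.ne']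
              linarith
          _ ≤ a₂ * M := e1
          _ ≤ _ := mul_le_mul_of_nonneg_right hK4.le hM0
      have h2 : (1 - 2 * δ) * B ≤ (1 + δ) * M := by
        refine le_of_mul_le_mul_left ?_ ha
        linarith
      rw [div_mul_eq_mul_div, le_div_iff₀ (by linarith), mul_comm]
      exact h2
    have e4 : ∑ n ∈ Finset.range m, P.real (A n) * tail F (x + b * n)
        ≤ (1 + δ) * ((1 + δ) / (1 - 2 * δ) * M + δ * tail F x) := by
      have h1 := mul_le_mul_of_nonneg_right hN hT
      have h2 : (∑ n ∈ Finset.range m, P.real (A n) * tail F (x + b * n)) / (1 + δ)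
          ≤ (1 + δ) / (1 - 2 * δ) * M + δ * tail F x := by linarith
      rwa [div_le_iff₀ (by linarith), mul_comm] at h2
    -- Replacing {τ > n} by the alive event costs at most P{M_τ > x} plus the clamped crossing
    -- probability, for every n; smallness of this sum makes the total cost negligible.
    have e5 : ∑ n ∈ Finset.range m, tail F (x + b * n) ≤ δ := by
      have h1 := (sum_tail_le hm x b m).trans hx3
      refine le_of_mul_le_mul_left ?_ hb0
      linarith
    calc ∑ n ∈ Finset.range m, P.real {ω | (n : ℕ∞) < τ ω} * tail F (x + b * n)
        ≤ ∑ n ∈ Finset.range m, (P.real (A n) + (M + P₃)) * tail F (x + b * n) :=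
          Finset.sum_le_sum fun n _ => mul_le_mul_of_nonneg_right
            (prob_lt_le_prob_aliveSet_add n) (tail_nonneg _)
      _ = ∑ n ∈ Finset.range m, P.real (A n) * tail F (x + b * n)
          + (∑ n ∈ Finset.range m, tail F (x + b * n)) * (M + P₃) := by
          rw [Finset.sum_mul, ← Finset.sum_add_distrib]
          exact Finset.sum_congr rfl fun n _ => by ring
      _ ≤ _ := by
          refine add_le_add e4 (mul_le_mul e5 (by linarith)
            (add_nonneg hM0 measureReal_nonneg) hδ.le)
  have hfin := expectedTailIntegral_le_of_sum_le (P := P) hτ ha hba hB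
  rw [← hE] at hfin
  have h1 : R ≤ (1 + 2 * δ) * ((1 + δ) * ((1 + δ) / (1 - 2 * δ) * M + δ * tail F x)
      + δ * (M + δ * tail F x)) := by
    have h2 := mul_le_mul_of_nonneg_left hfin (show 0 ≤ 1 / a by positivity)
    refine h2.trans_eq ?_
    rw [hb, ← mul_assoc, ← mul_assoc, one_div, inv_mul_cancel₀ ha.ne', one_mul]
  have h2 := mul_le_mul_of_nonneg_left hTR
    (show 0 ≤ (1 + 2 * δ) * (δ + 2 * δ ^ 2) by positivity)
  have h3 : (1 + 2 * δ) * ((1 + δ) * ((1 + δ) / (1 - 2 * δ) * M + δ * tail F x)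
      + δ * (M + δ * tail F x)) = (1 + 2 * δ) * ((1 + δ) ^ 2 / (1 - 2 * δ) + δ) * M
      + (1 + 2 * δ) * (δ + 2 * δ ^ 2) * tail F x := by ring
  linarith

end UniformBounds

theorem mainTheorem4 (F : Measure ℝ) [IsProbabilityMeasure F] (hF : StrongSubexponential F)
    (a : ℝ) (ha : 0 < a) (hmean : ∫ x, x ∂F = -a) :
    ∀ ε : ℝ, 0 < ε → ∃ x₀ : ℝ, ∀ x : ℝ, x₀ ≤ x →
      ∀ (Ω : Type*) [MeasurableSpace Ω] (P : Measure Ω) [IsProbabilityMeasure P]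
        (ξ : ℕ → Ω → ℝ), (∀ i, Measurable (ξ i)) → iIndepFun ξ P → (∀ i, P.map (ξ i) = F) →
      ∀ τ : Ω → ℕ∞, Measurable τ → (∀ᵐ ω ∂P, 1 ≤ τ ω) → NotDependOnFuture P ξ τ →
        |P.real {ω | (x : EReal) < walkMax ξ τ ω} /
          (1 / a * (expectedTailIntegral F P a τ x).toReal) - 1| ≤ ε := by
  intro ε hε
  set up : ℝ → ℝ := fun δ =>
    (1 + δ) ^ 2 / (1 - δ) ^ 2 * ((1 + δ) ^ 2 / (1 - 2 * δ) + δ * (1 + δ)) + δ * (1 + δ) with hup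
  -- At δ = 0 the upper constant is 1 and `lo` is ε, so by continuity one small δ serves both
  -- bounds; positivity of `lo` is the lower bound with factor 1 - ε after clearing the coefficient
  -- of the probability.
  set lo : ℝ → ℝ := fun δ => (1 - (1 + 2 * δ) * (1 + δ) * (δ + 2 * δ ^ 2))
    - (1 - ε) * ((1 + 2 * δ) * ((1 + δ) ^ 2 / (1 - 2 * δ) + δ)) with hlo
  have hdiv : ContinuousAt (fun δ : ℝ => (1 + δ) ^ 2 / (1 - 2 * δ)) 0 :=
    ContinuousAt.div (by fun_prop) (by fun_prop) (by norm_num)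
  have hupc : ContinuousAt up 0 :=
    ((ContinuousAt.div (by fun_prop) (by fun_prop) (by norm_num)).mul
      (hdiv.add (by fun_prop))).add (by fun_prop)
  have hloc : ContinuousAt lo 0 :=
    ContinuousAt.sub (by fun_prop)
      (continuousAt_const.mul (ContinuousAt.mul (by fun_prop) (hdiv.add (by fun_prop))))
  have h1 := hupc.eventually (gt_mem_nhds (show up 0 < 1 + ε by simp [hup, hε]))
  have h2 := hloc.eventually (lt_mem_nhds (show 0 < lo 0 by simp [hlo, hε]))
  have h3 := ((h1.and h2).and (gt_mem_nhds (show (0 : ℝ) < 1 / 4 by norm_num))).filter_mono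
    (nhdsWithin_le_nhds (s := Ioi 0))
  obtain ⟨δ, ⟨⟨hδup, hδlo⟩, hδ4⟩, hδ⟩ := (h3.and self_mem_nhdsWithin).exists
  have hδ : 0 < δ := hδ
  obtain ⟨x₀, hx₀⟩ := eventually_atTop.1
    (((hF.prob_walkMax_le ha hmean hδ hδ4).and (hF.le_prob_walkMax ha hmean hδ hδ4)).and
      (hF.exists_forall_tail_le a hδ))
  refine ⟨x₀, fun x hx Ω _ P _ ξ hξ hind hmap τ hτ hτ1 hfut => ?_⟩
  obtain ⟨⟨hU, hL⟩, hT⟩ := hx₀ x hx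
  have hU := hU Ω P ξ hξ hind hmap τ hτ hτ1 hfut
  have hL := hL Ω P ξ hξ hind hmap τ hτ hτ1 hfut
  have hTR := tail_le_expectedTailIntegral (P := P) hF.finite_mean hτ hτ1 ha hT hδ.le
  set R := 1 / a * (expectedTailIntegral F P a τ x).toReal with hR
  set M := P.real {ω | (x : EReal) < walkMax ξ τ ω} with hM
  have hR0 : 0 < R := by
    have := (hF.tail_pos x).trans_le hTR
    exact pos_of_mul_pos_right this (by linarith)
  have hMU : M ≤ (1 + ε) * R := hU.trans (mul_le_mul_of_nonneg_right hδup.le hR0.le)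
  have hML : (1 - ε) * R ≤ M := by
    set v := (1 + 2 * δ) * ((1 + δ) ^ 2 / (1 - 2 * δ) + δ) with hv
    have hv0 : 0 < v := by
      have : 0 < 1 - 2 * δ := by linarith
      positivity
    refine le_of_mul_le_mul_left ?_ hv0
    have h4 := mul_pos hδlo hR0
    simp only [hlo] at h4
    rw [← hv] at h4
    linarith
  rw [abs_le]
  constructor
  · rw [neg_le_sub_iff_le_add, ← sub_le_iff_le_add, le_div_iff₀ hR0]
    exact hML
  · rw [sub_le_iff_le_add, div_le_iff₀ hR0, add_comm ε 1]
    exact hMU
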